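/- Let $(\cdot,\cdot)$ be the Hilbert symbol of $\mathbb{Q}_2$. For $g=\begin{pmatrix}a&b\\c&d\end{pmatrix}\in \mathrm{SL}_2(\mathbb{Q}_2)$ put $x(g)=c$ if $c\neq0$ and $x(g)=d$ if $c=0$; put $s(g)=(c,d)$ if $cd\ne 0$ and $\mathrm{ord}(c)$ is odd, and $s(g)=1$ otherwise. Let $G=\mathrm{SL}_2(\mathbb{Q}_2)\times\{\pm1\}$ be the two-fold cover with multiplication $$(g_1,\epsilon_1)(g_2,\epsilon_2)=(g_1g_2,\ \epsilon_1\epsilon_2\,\sigma(g_1,g_2)),\qquad \sigma(g_1,g_2)=\bigl(x(g_1g_2)x(g_1),\,x(g_1g_2)x(g_2)\bigr)\,s(g_1)s(g_2)s(g_1g_2).$$ Let $K$ and $K_0$ be the inverse images in $G$ of $\mathrm{SL}_2(\mathbb{Z}_2)$ and of $\{g\in \mathrm{SL}_2(\mathbb{Z}_2): c\in4\mathbb{Z}_2\}$, and let $K_1=\{(g,1): g\in \mathrm{SL}_2(\mathbb{Z}_2),\ a\in1+4\mathbb{Z}_2,\ c\in4\mathbb{Z}_2\}$. The center $M$ of $G$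 is cyclic of order $4$, generated by $h(-1)=(-I,1)$, and $K_0=M\times K_1$. Let $w=\left(\begin{pmatrix}0&1\\-1&0\end{pmatrix},1\right)\in K$. Let $\gamma$ be a genuine character of $M$ (that is, $\gamma(I,-1)=-1$), extended to a character of $K_0$ that is trivial on $K_1$. Put $\zeta=(1+\gamma(h(-1)))/\sqrt2$, and let $$I_K(\gamma)=\mathrm{Ind}_{K_0}^K\gamma=\{\phi:K\to\mathbb{C} : \phi(k_0k)=\gamma(k_0)\phi(k)\ \text{for all } k_0\in K_0,\ k\in K\},$$ on which $K$ acts by right translation $\pi_R$. Let $dk$ be the Haar measure on $K$ for which $K_0$ has measure $1$, and let $$H_K(\gamma)=\{f:K\to\mathbb{C} : f(k_0kk_0')=\overline{\gamma}(k_0)f(k)\overline{\gamma}(k_0')\ \text{for all } k_0,k_0'\in K_0,\ k\in K\}.$$ Its unit $1$ (for convolution) is the function supported on $K_0$ and equal to $\overline\gamma$ there. Let $T_w\in H_K(\gamma)$ be the function supported on $K_0wK_0$ with $T_w(k_0wk_0')=\tfrac1{\sqrt2}\,\overline{\gamma}(k_0)\,\overline{\zeta}\,\overline{\gamma}(k_0')$;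 it is well defined. Put $F_{-1}=\frac13(2-T_w)$ and $F_2=\frac13(T_w+1)$. For $f\in H_K(\gamma)$ let $\hat f(g)=f(g^{-1})$, so that $\hat f\in H_K(\overline\gamma)$; for $f\in H_K(\overline\gamma)$ and $\phi\in I_K(\gamma)$ let $$(\pi_L(f)\phi)(g)=\int_K f(k)\phi(k^{-1}g)\,dk .$$ For $j\in\{-1,2\}$ let $V(j)=\pi_L(\hat F_j)\,I_K(\gamma)$, which is a $K$-submodule of $I_K(\gamma)$. Finally, let $I_K(\gamma)^\gamma=\{\phi\in I_K(\gamma):\pi_R(k_0)\phi=\gamma(k_0)\phi\ \text{for all } k_0\in K_0\}$. A $\gamma$-spherical vector of $I_K(\gamma)$ is a nonzero $\phi\in I_K(\gamma)^\gamma$ with $\pi_R(T_w)\phi=2\phi$, where $\pi_R(T_w)\phi=\int_K T_w(k)\,\pi_R(k)\phi\,dk$; the space of $\gamma$-spherical vectors is the set of these together with $0$. Then $\dim I_K(\gamma)=6$ and: (i) $I_K(\gamma)=V(-1)\oplus V(2)$, and each summand is an irreducible representation of $K$. (ii) $\dim V(-1)=4$ and $\dim V(2)=2$. (iii) $\hat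 F_2$ is a $\gamma$-spherical vector and lies in $V(2)$; the space of $\gamma$-spherical vectors is one-dimensional and is contained in $V(2)$. (iv) $V(-1)$ contains no $\gamma$-spherical vector. -/

import Mathlib

open Classical in
/-- The Hilbert symbol of a field. -/
noncomputable def hilbertSymbol {F : Type*} [Field F] (a b : F) : ℤˣ :=
  if ∃ x y z : F, (x ≠ 0 ∨ y ≠ 0 ∨ z ≠ 0) ∧ z ^ 2 = a * x ^ 2 + b * y ^ 2 then 1 else -1

namespace hilbertSymbol

section general
variable {F : Type*} [Field F]

theorem eq_one {a b : F} (x y z : F) (h : x ≠ 0 ∨ y ≠ 0 ∨ z ≠ 0)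
    (e : z ^ 2 = a * x ^ 2 + b * y ^ 2) : hilbertSymbol a b = 1 := by
  unfold hilbertSymbol
  rw [if_pos ⟨x, y, z, h, e⟩]

theorem comm (a b : F) : hilbertSymbol a b = hilbertSymbol b a := by
  unfold hilbertSymbol
  congr 1
  apply propext
  constructor <;> rintro ⟨x, y, z, h, e⟩ <;> exact ⟨y, x, z, by tauto, by rw [e]; ring⟩

theorem mul_sq_left (a b : F) {t : F} (ht : t ≠ 0) :
    hilbertSymbol (a * t ^ 2) b = hilbertSymbol a b := by
  unfold hilbertSymbol
  congr 1
  apply propext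
  constructor
  · rintro ⟨x, y, z, h, e⟩
    refine ⟨t * x, y, z, ?_, by rw [e]; ring⟩
    rcases h with h | h | h
    · exact Or.inl (mul_ne_zero ht h)
    · tauto
    · tauto
  · rintro ⟨x, y, z, h, e⟩
    refine ⟨x / t, y, z, ?_, by rw [e]; field_simp⟩
    rcases h with h | h | h
    · exact Or.inl (div_ne_zero h ht)
    · tauto
    · tauto

theorem mul_sq_right (a b : F) {t : F} (ht : t ≠ 0) :
    hilbertSymbol a (b * t ^ 2) = hilbertSymbol a b := by
  rw [comm, mul_sq_left _ _ ht, comm]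

theorem sq_left {t : F} (b : F) : hilbertSymbol (t ^ 2) b = 1 :=
  eq_one 1 0 t (by simp) (by ring)

theorem self_neg (a : F) : hilbertSymbol a (-a) = 1 :=
  eq_one 1 1 0 (by simp) (by ring)

theorem mul_self (a b : F) : hilbertSymbol a b * hilbertSymbol a b = 1 := by
  rcases Int.units_eq_one_or (hilbertSymbol a b) with h | h <;> simp [h]

end general

theorem isSquare_of_mod_eight {u : ℤ_[2]} (hu : PadicInt.toZModPow 3 u = 1) :
    ∃ w : ℤ_[2], u = w ^ 2 := by
  have h1 : u - 1 ∈ RingHom.ker (PadicInt.toZModPow (p := 2) 3) := by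
    rw [RingHom.mem_ker, map_sub, hu, map_one, sub_self]
  rw [PadicInt.ker_toZModPow, ← PadicInt.norm_le_pow_iff_mem_span_pow] at h1
  have h2 : ‖(2 : ℤ_[2])‖ = 1 / 2 := by
    have := PadicInt.norm_p (p := 2)
    push_cast at this
    rw [this]; norm_num
  obtain ⟨z, hz, -⟩ := hensels_lemma (p := 2) (R := ℤ_[2])
    (F := Polynomial.X ^ 2 - Polynomial.C u) (a := (1 : ℤ_[2])) (by
      simp only [map_sub, map_pow, Polynomial.aeval_X, Polynomial.aeval_C,
        Polynomial.derivative_X_pow, Polynomial.derivative_C, sub_zero, map_mul, one_pow]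
      norm_num [h2]
      rw [norm_sub_rev]
      refine lt_of_le_of_lt h1 ?_
      norm_num)
  refine ⟨z, ?_⟩
  simp only [map_sub, map_pow, Polynomial.aeval_X, Polynomial.aeval_C] at hz
  have := sub_eq_zero.mp hz
  simpa using this.symm

/-- Representatives of the classes of `ℚ₂ˣ` modulo squares. -/
def rep (i j k : Fin 2) : ℤ := (-1) ^ (i : ℕ) * 5 ^ (j : ℕ) * 2 ^ (k : ℕ)

theorem rep_ne_zero (i j k : Fin 2) : ((rep i j k : ℤ) : ℚ_[2]) ≠ 0 := by
  unfold rep; push_cast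
  exact mul_ne_zero (mul_ne_zero (pow_ne_zero _ (by norm_num)) (pow_ne_zero _ (by norm_num)))
    (pow_ne_zero _ (by norm_num))

theorem exists_rep {a : ℚ_[2]} (ha : a ≠ 0) :
    ∃ i j k : Fin 2, ∃ t : ℚ_[2], t ≠ 0 ∧ a = rep i j k * t ^ 2 := by
  have two : (2 : ℚ_[2]) ≠ 0 := by norm_num
  set n := a.valuation with hn
  have hu : ‖a * (2 : ℚ_[2]) ^ (-n)‖ = 1 := by
    rw [norm_mul, Padic.norm_eq_zpow_neg_valuation ha, norm_zpow]
    have : ‖(2 : ℚ_[2])‖ = (2 : ℝ)⁻¹ := by simpa using Padic.norm_p (p := 2)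
    rw [this, inv_zpow', Nat.cast_ofNat, ← zpow_add₀ (by norm_num)]
    simp [hn]
  set u : ℤ_[2] := ⟨_, hu.le⟩ with hudef
  have huu : IsUnit (PadicInt.toZModPow 3 u) := (PadicInt.isUnit_iff.2 hu).map _
  have key : ∀ c : ZMod (2 ^ 3), IsUnit c → ∃ i j : Fin 2,
      c * (((-1) ^ (i : ℕ) * 5 ^ (j : ℕ) : ℤ) : ZMod (2 ^ 3)) = 1 := by
    have : ∀ c : ZMod 8, (∃ d, c * d = 1) → ∃ i j : Fin 2,
      c * (((-1) ^ (i : ℕ) * 5 ^ (j : ℕ) : ℤ) : ZMod 8) = 1 := by decide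
    intro c hc
    exact this c (isUnit_iff_exists_inv.1 hc)
  obtain ⟨i, j, hij⟩ := key _ huu
  rw [← map_intCast (PadicInt.toZModPow (p := 2) 3), ← map_mul] at hij
  obtain ⟨w, hw⟩ := isSquare_of_mod_eight hij
  have hw' : a * (2 : ℚ_[2]) ^ (-n) * ((-1) ^ (i : ℕ) * 5 ^ (j : ℕ)) = (w : ℚ_[2]) ^ 2 := by
    have := congrArg (fun z : ℤ_[2] => (z : ℚ_[2])) hw
    simp only [PadicInt.coe_mul, PadicInt.coe_pow, PadicInt.coe_intCast] at this
    rw [← this]; push_cast; rfl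
  set e : ℚ_[2] := (-1) ^ (i : ℕ) * 5 ^ (j : ℕ) with he
  have e0 : e ≠ 0 := mul_ne_zero (pow_ne_zero _ (by norm_num)) (pow_ne_zero _ (by norm_num))
  have w0 : (w : ℚ_[2]) ≠ 0 := by
    intro h
    rw [h] at hw'
    have : a * (2 : ℚ_[2]) ^ (-n) * e ≠ 0 := mul_ne_zero (mul_ne_zero ha (zpow_ne_zero _ two)) e0
    exact this (by rw [hw']; ring)
  obtain ⟨m, k, hk⟩ : ∃ (m : ℤ) (k : Fin 2), n = m + m + (k : ℕ) := by
    rcases Int.even_or_odd' n with ⟨m, h | h⟩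
    · exact ⟨m, 0, by simp; omega⟩
    · exact ⟨m, 1, by simp; omega⟩
  refine ⟨i, j, k, w / e * 2 ^ m, mul_ne_zero (div_ne_zero w0 e0) (zpow_ne_zero _ two), ?_⟩
  have hr : ((rep i j k : ℤ) : ℚ_[2]) = e * 2 ^ (k : ℕ) := by
    unfold rep; push_cast; rw [he]
  have h2n : (2 : ℚ_[2]) ^ n = 2 ^ m * 2 ^ m * 2 ^ (k : ℕ) := by
    rw [hk, zpow_add₀ two, zpow_add₀ two, zpow_natCast]
  have h2n0 : (2 : ℚ_[2]) ^ n ≠ 0 := zpow_ne_zero _ two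
  rw [hr]
  calc a = (a * (2 : ℚ_[2]) ^ (-n) * e) / e * 2 ^ n := by
        rw [zpow_neg]; field_simp
    _ = _ := by rw [hw', h2n]; field_simp

/-- The exponent of `-1` in the explicit formula for the dyadic symbol. -/
def expo (i j k i' j' k' : Fin 2) : Fin 2 := i * i' + j * k' + k * j'

theorem pos_table : ∀ i j k i' j' k' : Fin 2, expo i j k i' j' k' = 0 →
    ∃ x y : Fin 4, ∃ l : Fin 2, (x ≠ 0 ∨ y ≠ 0) ∧
      ((rep i j k * (x : ℕ) ^ 2 + rep i' j' k' * (y : ℕ) ^ 2 = 0) ∨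
      ((rep i j k * (x : ℕ) ^ 2 + rep i' j' k' * (y : ℕ) ^ 2) % 4 ^ (l : ℕ) = 0 ∧
      ((rep i j k * (x : ℕ) ^ 2 + rep i' j' k' * (y : ℕ) ^ 2) / 4 ^ (l : ℕ)) % 8 = 1)) := by
  decide

/-- The squares modulo `16`. -/
def sqs (x : Fin 4) : ℤ := ![0, 1, 4, 9] x

theorem neg_table : ∀ i j k i' j' k' : Fin 2, expo i j k i' j' k' = 1 →
    ∀ x y z : Fin 4, (rep i j k * sqs x + rep i' j' k' * sqs y - sqs z) % 16 = 0 →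
      sqs x % 4 = 0 ∧ sqs y % 4 = 0 ∧ sqs z % 4 = 0 := by
  decide

theorem sqs_spec : ∀ x : ZMod 16, ∃ s : Fin 4, x ^ 2 = (sqs s : ZMod 16) ∧
    (sqs s % 4 = 0 → ∃ d, x = 2 * d) := by
  decide

theorem two_dvd_of_toZModPow {x : ℤ_[2]} (h : ∃ d, PadicInt.toZModPow 4 x = 2 * d) : ‖x‖ < 1 := by
  obtain ⟨d, hd⟩ := h
  have hn : ¬ IsUnit (PadicInt.toZModPow 4 x) := by
    rw [hd]
    have : ∀ d : ZMod 16, ∀ e : ZMod 16, 2 * d * e ≠ 1 := by decide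
    intro h
    obtain ⟨e, he⟩ := isUnit_iff_exists_inv.1 h
    exact this d e he
  rw [← PadicInt.not_isUnit_iff]
  exact fun h => hn (h.map _)

theorem exists_primitive {a b x y z : ℚ_[2]} (h : x ≠ 0 ∨ y ≠ 0 ∨ z ≠ 0)
    (e : z ^ 2 = a * x ^ 2 + b * y ^ 2) :
    ∃ x' y' z' : ℤ_[2], ¬ (‖x'‖ < 1 ∧ ‖y'‖ < 1 ∧ ‖z'‖ < 1) ∧
      (z' : ℚ_[2]) ^ 2 = a * x' ^ 2 + b * y' ^ 2 := by
  obtain ⟨m, hm0, hx, hy, hz, hm⟩ : ∃ m : ℚ_[2], m ≠ 0 ∧ ‖x‖ ≤ ‖m‖ ∧ ‖y‖ ≤ ‖m‖ ∧ ‖z‖ ≤ ‖m‖ ∧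
      (m = x ∨ m = y ∨ m = z) := by
    clear e
    rcases le_total ‖x‖ ‖y‖ with h1 | h1 <;> rcases le_total ‖y‖ ‖z‖ with h2 | h2 <;>
      rcases le_total ‖x‖ ‖z‖ with h3 | h3
    · exact ⟨z, by rintro rfl; simp_all, h3, h2, le_rfl, by tauto⟩
    · exact ⟨z, by rintro rfl; simp_all, h1.trans h2, h2, le_rfl, by tauto⟩
    · exact ⟨y, by rintro rfl; simp_all, h1, le_rfl, h2, by tauto⟩
    · exact ⟨y, by rintro rfl; simp_all, h1, le_rfl, h2, by tauto⟩
    · exact ⟨z, by rintro rfl; simp_all, h3, h2, le_rfl, by tauto⟩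
    · exact ⟨x, by rintro rfl; simp_all, le_rfl, h1, h3, by tauto⟩
    · exact ⟨z, by rintro rfl; simp_all, h3, h1.trans h3, le_rfl, by tauto⟩
    · exact ⟨x, by rintro rfl; simp_all, le_rfl, h1, h3, by tauto⟩
  have key : ∀ {w : ℚ_[2]}, ‖w‖ ≤ ‖m‖ → ‖w / m‖ ≤ 1 := fun hw => by
    rw [norm_div]; exact div_le_one_of_le₀ hw (norm_nonneg _)
  refine ⟨⟨x / m, key hx⟩, ⟨y / m, key hy⟩, ⟨z / m, key hz⟩, ?_, ?_⟩
  · rintro ⟨h1, h2, h3⟩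
    change ‖x / m‖ < 1 at h1
    change ‖y / m‖ < 1 at h2
    change ‖z / m‖ < 1 at h3
    rcases hm with rfl | rfl | rfl
    · simp [hm0] at h1
    · simp [hm0] at h2
    · simp [hm0] at h3
  · show (z / m) ^ 2 = a * (x / m) ^ 2 + b * (y / m) ^ 2
    rw [div_pow, e]; field_simp

/-- The sign attached to a parity. -/
def sgn (e : Fin 2) : ℤˣ := (-1) ^ (e : ℕ)

/-- The explicit dyadic formula on representatives. -/
theorem rep_rep (i j k i' j' k' : Fin 2) :
    hilbertSymbol ((rep i j k : ℤ) : ℚ_[2]) ((rep i' j' k' : ℤ) : ℚ_[2])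
      = sgn (expo i j k i' j' k') := by
  obtain h | h : expo i j k i' j' k' = 0 ∨ expo i j k i' j' k' = 1 := by
    generalize expo i j k i' j' k' = e
    revert e; decide
  · rw [h, show sgn 0 = 1 by decide]
    obtain ⟨x, y, l, hxy, ht⟩ := pos_table i j k i' j' k' h
    have hxy' : ((x : ℕ) : ℚ_[2]) ≠ 0 ∨ ((y : ℕ) : ℚ_[2]) ≠ 0 := by
      rcases hxy with h | h
      · exact Or.inl (Nat.cast_ne_zero.2 fun h0 => h (Fin.ext h0))
      · exact Or.inr (Nat.cast_ne_zero.2 fun h0 => h (Fin.ext h0))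
    have hn : ((rep i j k : ℤ) : ℚ_[2]) * ((x : ℕ) : ℚ_[2]) ^ 2 +
        ((rep i' j' k' : ℤ) : ℚ_[2]) * ((y : ℕ) : ℚ_[2]) ^ 2 =
        ((rep i j k * (x : ℕ) ^ 2 + rep i' j' k' * (y : ℕ) ^ 2 : ℤ) : ℚ_[2]) := by
      push_cast; rfl
    generalize rep i j k * (x : ℕ) ^ 2 + rep i' j' k' * (y : ℕ) ^ 2 = n at ht hn
    rcases ht with rfl | ⟨h1, h2⟩
    · exact eq_one (x : ℕ) (y : ℕ) 0 (by tauto) (by rw [hn]; simp)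
    · obtain ⟨q, rfl⟩ := Int.dvd_of_emod_eq_zero h1
      rw [Int.mul_ediv_cancel_left _ (by positivity)] at h2
      obtain ⟨w, hw⟩ := isSquare_of_mod_eight (u := (q : ℤ_[2])) (by
        rw [map_intCast]
        have : ((q - 1 : ℤ) : ZMod 8) = 0 := by
          rw [ZMod.intCast_zmod_eq_zero_iff_dvd]; omega
        rw [Int.cast_sub, Int.cast_one, sub_eq_zero] at this
        exact this)
      have hw' := congrArg (fun z : ℤ_[2] => (z : ℚ_[2])) hw
      simp only [PadicInt.coe_intCast, PadicInt.coe_pow] at hw'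
      refine eq_one (x : ℕ) (y : ℕ) (2 ^ (l : ℕ) * w) (by tauto) ?_
      rw [hn]; push_cast; rw [hw', mul_pow, ← pow_mul, mul_comm (l : ℕ) 2, pow_mul]
      norm_num
  · rw [h, show sgn 1 = -1 by decide]
    unfold hilbertSymbol
    rw [if_neg]
    rintro ⟨x, y, z, hne, e⟩
    obtain ⟨x, y, z, hp, e⟩ := exists_primitive hne e
    have e' : z ^ 2 = (rep i j k : ℤ_[2]) * x ^ 2 + (rep i' j' k' : ℤ_[2]) * y ^ 2 := by
      apply PadicInt.ext; push_cast; exact e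
    have e2 := congrArg (PadicInt.toZModPow (p := 2) 4) e'
    simp only [map_add, map_mul, map_pow, map_intCast] at e2
    obtain ⟨s, hs, hs'⟩ := sqs_spec (PadicInt.toZModPow 4 x)
    obtain ⟨t, ht, ht'⟩ := sqs_spec (PadicInt.toZModPow 4 y)
    obtain ⟨u, hu, hu'⟩ := sqs_spec (PadicInt.toZModPow 4 z)
    have e3 : ((rep i j k * sqs s + rep i' j' k' * sqs t - sqs u : ℤ) : ZMod 16) = 0 := by
      push_cast
      rw [← hs, ← ht, ← hu, sub_eq_zero]
      exact e2.symm
    rw [ZMod.intCast_zmod_eq_zero_iff_dvd] at e3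
    obtain ⟨h1, h2, h3⟩ := neg_table i j k i' j' k' h s t u (Int.emod_eq_zero_of_dvd e3)
    exact hp ⟨two_dvd_of_toZModPow (hs' h1), two_dvd_of_toZModPow (ht' h2),
      two_dvd_of_toZModPow (hu' h3)⟩

theorem rep_mul : ∀ i j k i' j' k' : Fin 2, rep i j k * rep i' j' k' =
    rep (i + i') (j + j') (k + k') * (5 ^ ((j : ℕ) * j') * 2 ^ ((k : ℕ) * k')) ^ 2 := by
  decide

theorem sgn_mul : ∀ i j k i' j' k' i'' j'' k'' : Fin 2,
    sgn (expo i j k (i' + i'') (j' + j'') (k' + k'')) =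
      sgn (expo i j k i' j' k') * sgn (expo i j k i'' j'' k'') := by
  decide

/-- Bimultiplicativity of the dyadic Hilbert symbol. -/
theorem mul_right {a b c : ℚ_[2]} (ha : a ≠ 0) (hb : b ≠ 0) (hc : c ≠ 0) :
    hilbertSymbol a (b * c) = hilbertSymbol a b * hilbertSymbol a c := by
  obtain ⟨i, j, k, r, hr, rfl⟩ := exists_rep ha
  obtain ⟨i', j', k', s, hs, rfl⟩ := exists_rep hb
  obtain ⟨i'', j'', k'', t, ht, rfl⟩ := exists_rep hc
  have h5 : (5 : ℚ_[2]) ≠ 0 := by norm_num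
  have h2 : (2 : ℚ_[2]) ≠ 0 := by norm_num
  have e : ((rep i' j' k' : ℤ) : ℚ_[2]) * s ^ 2 * (((rep i'' j'' k'' : ℤ) : ℚ_[2]) * t ^ 2) =
      ((rep (i' + i'') (j' + j'') (k' + k'') : ℤ) : ℚ_[2]) *
        (5 ^ ((j' : ℕ) * j'') * 2 ^ ((k' : ℕ) * k'') * s * t) ^ 2 := by
    have := congrArg (fun z : ℤ => (z : ℚ_[2])) (rep_mul i' j' k' i'' j'' k'')
    push_cast at this
    linear_combination s ^ 2 * t ^ 2 * this
  rw [e, mul_sq_left _ _ hr, mul_sq_left _ _ hr, mul_sq_left _ _ hr, mul_sq_right _ _ hs,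
    mul_sq_right _ _ ht, mul_sq_right, rep_rep, rep_rep, rep_rep, sgn_mul]
  exact mul_ne_zero (mul_ne_zero (mul_ne_zero (pow_ne_zero _ h5) (pow_ne_zero _ h2)) hs) ht

theorem mul_left {a b c : ℚ_[2]} (ha : a ≠ 0) (hb : b ≠ 0) (hc : c ≠ 0) :
    hilbertSymbol (a * b) c = hilbertSymbol a c * hilbertSymbol b c := by
  rw [comm, mul_right hc ha hb, comm c a, comm c b]

end hilbertSymbol

/-- `SL₂(ℚ₂)`. -/
abbrev SLQ : Type := Matrix.SpecialLinearGroup (Fin 2) ℚ_[2]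

open Classical in
/-- `x(g)`: the lower left entry `c`, or the lower right entry `d` if `c = 0`. -/
noncomputable def xfun (g : SLQ) : ℚ_[2] := if g 1 0 ≠ 0 then g 1 0 else g 1 1

open Classical in
/-- `s(g)`: the Hilbert symbol `(c, d)` if `cd ≠ 0` and `ord c` is odd, and `1` otherwise. -/
noncomputable def sfun (g : SLQ) : ℤˣ :=
  if g 1 0 * g 1 1 ≠ 0 ∧ Odd (g 1 0).valuation then hilbertSymbol (g 1 0) (g 1 1) else 1

/-- The cocycle `σ` on `SL₂(ℚ₂)`. -/
noncomputable def sigma (g₁ g₂ : SLQ) : ℤˣ :=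
  hilbertSymbol (xfun (g₁ * g₂) * xfun g₁) (xfun (g₁ * g₂) * xfun g₂) *
    sfun g₁ * sfun g₂ * sfun (g₁ * g₂)

namespace sigma

/-- The isomorphism of `{±1}` with `ℤ/2`, used to linearise identities between symbols. -/
def lam (u : ℤˣ) : ZMod 2 := if u = 1 then 0 else 1

theorem lam_mul : ∀ u v : ℤˣ, lam (u * v) = lam u + lam v := by decide
theorem lam_inj : ∀ u v : ℤˣ, lam u = lam v → u = v := by decide

/-- The Hilbert symbol written additively. -/
noncomputable def ad (a b : ℚ_[2]) : ZMod 2 := lam (hilbertSymbol a b)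

theorem ad_comm (a b : ℚ_[2]) : ad a b = ad b a := by unfold ad; rw [hilbertSymbol.comm]

theorem ad_mul_left {a b c : ℚ_[2]} (ha : a ≠ 0) (hb : b ≠ 0) (hc : c ≠ 0) :
    ad (a * b) c = ad a c + ad b c := by
  unfold ad; rw [hilbertSymbol.mul_left ha hb hc, lam_mul]

theorem ad_mul_right {a b c : ℚ_[2]} (ha : a ≠ 0) (hb : b ≠ 0) (hc : c ≠ 0) :
    ad a (b * c) = ad a b + ad a c := by
  unfold ad; rw [hilbertSymbol.mul_right ha hb hc, lam_mul]

theorem ad_self {a : ℚ_[2]} (ha : a ≠ 0) : ad a a = ad a (-1) := by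
  have h : ad a (-1 * a) = 0 := by
    unfold ad; rw [neg_one_mul, hilbertSymbol.self_neg]; rfl
  rw [ad_mul_right ha (by norm_num) ha] at h
  generalize ad a a = p at *
  generalize ad a (-1) = q at *
  revert p q; decide

theorem two_mul' (a : ZMod 2) : a + a = 0 := by revert a; decide

theorem xfun_ne_zero (g : SLQ) : xfun g ≠ 0 := by
  unfold xfun
  split_ifs with h
  · exact h
  · intro h1
    have := g.det_coe
    rw [Matrix.det_fin_two, h1] at this
    simp only [not_not] at h
    rw [h] at this
    simp at this

theorem det_eq (g : SLQ) : g 0 0 * g 1 1 - g 0 1 * g 1 0 = 1 := by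
  rw [← Matrix.det_fin_two, g.det_coe]

theorem mul10 (g h : SLQ) : (g * h) 1 0 = g 1 0 * h 0 0 + g 1 1 * h 1 0 := by
  simp [Matrix.mul_apply, Fin.sum_univ_two]

theorem mul11 (g h : SLQ) : (g * h) 1 1 = g 1 0 * h 0 1 + g 1 1 * h 1 1 := by
  simp [Matrix.mul_apply, Fin.sum_univ_two]

theorem xfun_of_ne {g : SLQ} (h : g 1 0 ≠ 0) : xfun g = g 1 0 := by simp [xfun, h]

theorem xfun_of_eq {g : SLQ} (h : g 1 0 = 0) : xfun g = g 1 1 := by simp [xfun, h]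

theorem diag {b : SLQ} (h : b 1 0 = 0) : b 0 0 * b 1 1 = 1 := by
  have := det_eq b
  rw [h] at this
  linear_combination this

theorem xfun_mul_left {b : SLQ} (h : b 1 0 = 0) (g : SLQ) : xfun (b * g) = xfun b * xfun g := by
  rw [xfun_of_eq h]
  have hd : b 1 1 ≠ 0 := right_ne_zero_of_mul_eq_one (diag h)
  by_cases hg : g 1 0 = 0
  · rw [xfun_of_eq hg, xfun_of_eq, mul11, h]
    · ring
    · rw [mul10, h, hg]; ring
  · rw [xfun_of_ne hg, xfun_of_ne, mul10, h]
    · ring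
    · rw [mul10, h]
      simpa using ⟨hd, hg⟩

theorem xfun_mul_right {b : SLQ} (h : b 1 0 = 0) (g : SLQ) :
    ∃ t : ℚ_[2], t ≠ 0 ∧ xfun (g * b) = xfun g * xfun b * (t * t) := by
  rw [xfun_of_eq h]
  have hd : b 1 1 ≠ 0 := right_ne_zero_of_mul_eq_one (diag h)
  have ha : b 0 0 ≠ 0 := left_ne_zero_of_mul_eq_one (diag h)
  by_cases hg : g 1 0 = 0
  · refine ⟨1, one_ne_zero, ?_⟩
    rw [xfun_of_eq hg, xfun_of_eq, mul11, hg]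
    · ring
    · rw [mul10, h, hg]; ring
  · refine ⟨b 0 0, ha, ?_⟩
    rw [xfun_of_ne hg, xfun_of_ne, mul10, h]
    · linear_combination -(g 1 0 * b 0 0) * diag h
    · rw [mul10, h]
      simpa using ⟨hg, ha⟩

/-- The cocycle without its coboundary factors, written additively. -/
noncomputable def kap (g h : SLQ) : ZMod 2 := 
  ad (xfun (g * h) * xfun g) (xfun (g * h) * xfun h)

theorem kap_eq (g h : SLQ) : kap g h = ad (xfun (g * h)) (-1) + ad (xfun (g * h)) (xfun h) +
    ad (xfun g) (xfun (g * h)) + ad (xfun g) (xfun h) := by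
  have h1 := xfun_ne_zero g
  have h2 := xfun_ne_zero h
  have h3 := xfun_ne_zero (g * h)
  rw [kap, ad_mul_left h3 h1 (mul_ne_zero h3 h2), ad_mul_right h3 h3 h2, ad_mul_right h1 h3 h2,
    ad_self h3]
  ring

theorem ad_sq {t : ℚ_[2]} (ht : t ≠ 0) {a : ℚ_[2]} (ha : a ≠ 0) : ad (t * t) a = 0 := by
  rw [ad_mul_left ht ht ha, two_mul']

theorem kap_cocycle (g₁ g₂ g₃ : SLQ) :
    kap g₁ g₂ + kap (g₁ * g₂) g₃ = kap g₁ (g₂ * g₃) + kap g₂ g₃ := by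
  simp only [kap_eq]
  rw [mul_assoc]
  have n1 := xfun_ne_zero g₁
  have n2 := xfun_ne_zero g₂
  have n3 := xfun_ne_zero g₃
  have n12 := xfun_ne_zero (g₁ * g₂)
  have n23 := xfun_ne_zero (g₂ * g₃)
  have n123 := xfun_ne_zero (g₁ * (g₂ * g₃))
  have m1 : (-1 : ℚ_[2]) ≠ 0 := by norm_num
  by_cases c1 : g₁ 1 0 = 0
  · rw [xfun_mul_left c1, xfun_mul_left c1]
    generalize xfun g₁ = x1 at *
    generalize xfun g₂ = x2 at *
    generalize xfun g₃ = x3 at *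
    generalize xfun (g₂ * g₃) = x23 at *
    simp (disch := simp [*]) only [ad_mul_left, ad_mul_right, ad_self]
    clear * -
    grind [ad_comm]
  by_cases c3 : g₃ 1 0 = 0
  · obtain ⟨t, t0, ht⟩ := xfun_mul_right c3 g₂
    obtain ⟨u, u0, hu⟩ := xfun_mul_right c3 (g₁ * g₂)
    rw [← mul_assoc, ht, hu]
    generalize xfun g₁ = x1 at *
    generalize xfun g₂ = x2 at *
    generalize xfun g₃ = x3 at *
    generalize xfun (g₁ * g₂) = x12 at *
    simp (disch := simp [*]) only [ad_mul_left, ad_mul_right, ad_self]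
    clear * -
    grind [ad_comm]
  by_cases c2 : g₂ 1 0 = 0
  · obtain ⟨t, t0, ht⟩ := xfun_mul_right c2 g₁
    rw [xfun_mul_left c2, ht]
    generalize xfun g₁ = x1 at *
    generalize xfun g₂ = x2 at *
    generalize xfun g₃ = x3 at *
    generalize xfun (g₁ * (g₂ * g₃)) = x123 at *
    simp (disch := simp [*]) only [ad_mul_left, ad_mul_right, ad_self]
    clear * -
    grind [ad_comm]
  have e1 := xfun_of_ne c1
  have e2 := xfun_of_ne c2
  have e3 := xfun_of_ne c3
  have d2 := det_eq g₂
  have a12 := mul10 g₁ g₂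
  have a23 := mul10 g₂ g₃
  have b12 := mul11 g₁ g₂
  have b23 := mul11 g₂ g₃
  have a123 := mul10 g₁ (g₂ * g₃)
  have a123' := mul10 (g₁ * g₂) g₃
  have b123 := mul11 g₁ (g₂ * g₃)
  have b123' := mul11 (g₁ * g₂) g₃
  rw [mul_assoc] at a123' b123'
  by_cases c12 : (g₁ * g₂) 1 0 = 0
  · have h1 : xfun g₁ = -1 * (xfun (g₁ * g₂) * xfun g₂) := by
      rw [xfun_of_eq c12, e1, e2, b12]
      rw [c12] at a12
      linear_combination (-g₁ 1 0) * d2 - g₂ 1 1 * a12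
    have h123 : xfun (g₁ * (g₂ * g₃)) = xfun (g₁ * g₂) * xfun g₃ := by
      rw [← mul_assoc, xfun_mul_left c12]
    rw [h1, h123]
    rw [h1] at n1
    generalize xfun g₂ = x2 at *
    generalize xfun g₃ = x3 at *
    generalize xfun (g₁ * g₂) = x12 at *
    generalize xfun (g₂ * g₃) = x23 at *
    simp (disch := simp [*]) only [ad_mul_left, ad_mul_right, ad_self]
    clear * -
    grind [ad_comm]
  by_cases c23 : (g₂ * g₃) 1 0 = 0
  · have h2 : xfun g₂ = -1 * (xfun (g₂ * g₃) * xfun g₃) := by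
      have d3 := det_eq g₃
      rw [xfun_of_eq c23, e2, e3, b23]
      rw [c23] at a23
      linear_combination (-g₂ 1 0) * d3 - g₃ 1 1 * a23
    obtain ⟨t, t0, ht⟩ := xfun_mul_right c23 g₁
    rw [h2, ht]
    generalize xfun g₁ = x1 at *
    generalize xfun g₃ = x3 at *
    generalize xfun (g₁ * g₂) = x12 at *
    generalize xfun (g₂ * g₃) = x23 at *
    simp (disch := simp [*]) only [ad_mul_left, ad_mul_right, ad_self]
    clear * -
    grind [ad_comm]
  by_cases c123 : (g₁ * (g₂ * g₃)) 1 0 = 0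
  · have h12 : xfun (g₁ * g₂) = -1 * (xfun (g₁ * (g₂ * g₃)) * xfun g₃) := by
      have d3 := det_eq g₃
      rw [xfun_of_eq c123, xfun_of_ne c12, e3, b123']
      rw [c123] at a123'
      linear_combination (-(g₁ * g₂) 1 0) * d3 - g₃ 1 1 * a123'
    have h1 : xfun g₁ = -1 * (xfun (g₁ * (g₂ * g₃)) * xfun (g₂ * g₃)) := by
      have d23 := det_eq (g₂ * g₃)
      rw [xfun_of_eq c123, xfun_of_ne c23, e1, b123]
      rw [c123] at a123
      linear_combination (-g₁ 1 0) * d23 - (g₂ * g₃) 1 1 * a123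
    rw [h12, h1]
    generalize xfun g₂ = x2 at *
    generalize xfun g₃ = x3 at *
    generalize xfun (g₁ * (g₂ * g₃)) = x123 at *
    generalize xfun (g₂ * g₃) = x23 at *
    simp (disch := simp [*]) only [ad_mul_left, ad_mul_right, ad_self]
    clear * -
    grind [ad_comm]
  have key : ad ((xfun g₁ * xfun g₃) * (xfun (g₁ * g₂) * xfun (g₂ * g₃)))
      ((xfun g₂ * xfun (g₁ * (g₂ * g₃))) * (xfun (g₁ * g₂) * xfun (g₂ * g₃))) = 0 := by
    have rel : xfun g₂ * xfun (g₁ * (g₂ * g₃)) =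
        xfun (g₁ * g₂) * xfun (g₂ * g₃) - xfun g₁ * xfun g₃ := by
      have q := det_eq g₂
      have a1 : (g₂ * g₃) 0 0 = g₂ 0 0 * g₃ 0 0 + g₂ 0 1 * g₃ 1 0 := by
        simp [Matrix.mul_apply, Fin.sum_univ_two]
      rw [xfun_of_ne c123, xfun_of_ne c23, xfun_of_ne c12, e1, e2, e3, a123, a12, a23, a1]
      linear_combination (-g₁ 1 0 * g₃ 1 0) * q
    unfold ad
    rw [hilbertSymbol.eq_one 1 1 (xfun (g₁ * g₂) * xfun (g₂ * g₃)) (by simp)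
      (by rw [rel]; ring)]
    rfl
  generalize xfun g₁ = x1 at *
  generalize xfun g₂ = x2 at *
  generalize xfun g₃ = x3 at *
  generalize xfun (g₁ * (g₂ * g₃)) = x123 at *
  generalize xfun (g₁ * g₂) = x12 at *
  generalize xfun (g₂ * g₃) = x23 at *
  simp (disch := simp [*]) only [ad_mul_left, ad_mul_right, ad_self] at key ⊢
  clear * - key
  grind [ad_comm]

theorem cocycle (g₁ g₂ g₃ : SLQ) :
    sigma g₁ g₂ * sigma (g₁ * g₂) g₃ = sigma g₁ (g₂ * g₃) * sigma g₂ g₃ := by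
  have h := kap_cocycle g₁ g₂ g₃
  apply lam_inj
  unfold kap ad at h
  rw [mul_assoc] at h
  simp only [sigma, lam_mul]
  rw [mul_assoc]
  generalize lam (sfun g₁) = s1
  generalize lam (sfun g₂) = s2
  generalize lam (sfun g₃) = s3
  have := two_mul' (lam (sfun (g₁ * g₂)))
  have := two_mul' (lam (sfun (g₂ * g₃)))
  linear_combination h + (two_mul' (lam (sfun (g₁ * g₂)))) - (two_mul' (lam (sfun (g₂ * g₃))))

theorem one_left (g : SLQ) : sigma 1 g = 1 := by
  have h : xfun (1 : SLQ) = 1 := by simp [xfun]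
  have hs : sfun (1 : SLQ) = 1 := by simp [sfun]
  have hh : hilbertSymbol (xfun g) (xfun g * xfun g) = 1 := by
    rw [hilbertSymbol.comm, ← sq, hilbertSymbol.sq_left]
  rw [sigma, one_mul, h, hs, mul_one, mul_one, hh, one_mul]
  exact Int.units_mul_self _

theorem one_right (g : SLQ) : sigma g 1 = 1 := by
  have h : xfun (1 : SLQ) = 1 := by simp [xfun]
  have hs : sfun (1 : SLQ) = 1 := by simp [sfun]
  have hh : hilbertSymbol (xfun g * xfun g) (xfun g) = 1 := by
    rw [← sq, hilbertSymbol.sq_left]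
  rw [sigma, mul_one, h, hs, mul_one, mul_one, hh, one_mul]
  exact Int.units_mul_self _

theorem inv_comm (g : SLQ) : sigma g⁻¹ g = sigma g g⁻¹ := by
  have := cocycle g g⁻¹ g
  simpa [one_left, one_right] using this.symm

end sigma

/-- The two-fold cover `G` of `SL₂(ℚ₂)`: the set `SL₂(ℚ₂) × {±1}` with multiplication
twisted by `σ`. -/
@[ext]
structure Cover where
  /-- the matrix -/
  mat : SLQ
  /-- the sign -/
  sign : ℤˣ

namespace Cover

noncomputable instance : Mul Cover := ⟨fun g h => ⟨g.mat * h.mat, g.sign * h.sign * sigma g.mat h.mat⟩⟩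
noncomputable instance : One Cover := ⟨⟨1, 1⟩⟩
noncomputable instance : Inv Cover := ⟨fun g => ⟨g.mat⁻¹, g.sign * sigma g.mat g.mat⁻¹⟩⟩

theorem mul_mat (g h : Cover) : (g * h).mat = g.mat * h.mat := rfl
theorem mul_sign (g h : Cover) : (g * h).sign = g.sign * h.sign * sigma g.mat h.mat := rfl
theorem one_mat : (1 : Cover).mat = 1 := rfl
theorem one_sign : (1 : Cover).sign = 1 := rfl
theorem inv_mat (g : Cover) : g⁻¹.mat = g.mat⁻¹ := rfl
theorem inv_sign (g : Cover) : g⁻¹.sign = g.sign * sigma g.mat g.mat⁻¹ := rfl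

noncomputable instance : Group Cover :=
  Group.ofLeftAxioms
    (fun a b c => by
      ext1
      · simp only [mul_mat, mul_assoc]
      · simp only [mul_mat, mul_sign]
        rw [mul_assoc a.sign, mul_assoc a.sign]
        have := sigma.cocycle a.mat b.mat c.mat
        calc _ = a.sign * b.sign * c.sign *
              (sigma a.mat b.mat * sigma (a.mat * b.mat) c.mat) := by
              simp only [mul_assoc, mul_comm, mul_left_comm]
          _ = _ := by rw [this]; simp only [mul_assoc, mul_comm, mul_left_comm])
    (fun a => by
      ext1
      · simp only [mul_mat, one_mat, one_mul]
      · simp only [mul_sign, one_mat, one_sign, one_mul, sigma.one_left, mul_one])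
    (fun a => by
      ext1
      · simp only [mul_mat, one_mat, inv_mat, inv_mul_cancel]
      · simp only [mul_sign, one_sign, inv_mat, inv_sign, sigma.inv_comm]
        have h1 := Int.units_mul_self a.sign
        have h2 := Int.units_mul_self (sigma a.mat a.mat⁻¹)
        calc _ = (a.sign * a.sign) * (sigma a.mat a.mat⁻¹ * sigma a.mat a.mat⁻¹) := by
              simp only [mul_assoc, mul_comm, mul_left_comm]
          _ = 1 := by rw [h1, h2, one_mul])

/-- The projection `G → SL₂(ℚ₂)`. -/
noncomputable def pr : Cover →* SLQ where
  toFun := mat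
  map_one' := rfl
  map_mul' _ _ := rfl

/-- The section `𝐬 : SL₂(ℚ₂) → G`. -/
def sec (g : SLQ) : Cover := ⟨g, 1⟩

end Cover

namespace Cover

/-- `SL₂(ℤ₂)`. -/
abbrev SLZ : Type := Matrix.SpecialLinearGroup (Fin 2) ℤ_[2]

/-- The inclusion `SL₂(ℤ₂) → SL₂(ℚ₂)`. -/
noncomputable def toQ : SLZ →* SLQ := Matrix.SpecialLinearGroup.map PadicInt.Coe.ringHom

theorem toQ_apply (g : SLZ) (i j : Fin 2) : toQ g i j = ((g i j : ℤ_[2]) : ℚ_[2]) := rfl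

theorem toQ_injective : Function.Injective toQ := by
  intro g h e
  ext i j
  have := congrArg (fun m : SLQ => m i j) e
  simp only [toQ_apply] at this
  exact PadicInt.ext this

/-- `K`, the inverse image of `SL₂(ℤ₂)` in `G`. -/
noncomputable def K : Subgroup Cover := toQ.range.comap pr

/-- The projection `K → SL₂(ℤ₂)`. -/
noncomputable def prZ : K →* SLZ :=
  (MonoidHom.ofInjective toQ_injective).symm.toMonoidHom.comp
    ((pr.comp K.subtype).codRestrict toQ.range fun k => k.2)

theorem toQ_prZ (k : K) : toQ (prZ k) = k.1.mat :=
  MonoidHom.apply_ofInjective_symm toQ_injective _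

theorem prZ_eq {k : K} {g : SLZ} (h : k.1.mat = toQ g) : prZ k = g :=
  toQ_injective ((toQ_prZ k).trans h)

/-- The element `(g, ε)` of `K`, for `g` in `SL₂(ℤ₂)`. -/
noncomputable def mkK (g : SLZ) (ε : ℤˣ) : K := ⟨⟨toQ g, ε⟩, ⟨g, rfl⟩⟩

theorem prZ_mkK (g : SLZ) (ε : ℤˣ) : prZ (mkK g ε) = g := prZ_eq rfl

theorem K_ext {k l : K} (h : prZ k = prZ l) (h' : k.1.sign = l.1.sign) : k = l := by
  apply Subtype.ext
  apply Cover.ext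
  · rw [← toQ_prZ, ← toQ_prZ, h]
  · exact h'

theorem sign_mul (k l : K) :
    (k * l).1.sign = k.1.sign * l.1.sign * sigma (toQ (prZ k)) (toQ (prZ l)) := by
  rw [toQ_prZ, toQ_prZ]; rfl

theorem sign_inv (k : K) :
    (k⁻¹).1.sign = k.1.sign * sigma (toQ (prZ k)) (toQ (prZ k⁻¹)) := by
  rw [toQ_prZ, toQ_prZ]; rfl

/-- The subgroup `{c ∈ 4ℤ₂}` of `SL₂(ℤ₂)`. -/
def Γ₀4 : Subgroup SLZ where
  carrier := {g | 4 ∣ g 1 0}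
  one_mem' := by simp
  mul_mem' := by
    intro g h hg hh
    show (4 : ℤ_[2]) ∣ (g * h) 1 0
    have : (g * h) 1 0 = g 1 0 * h 0 0 + g 1 1 * h 1 0 := by
      simp [Matrix.mul_apply, Fin.sum_univ_two]
    rw [this]
    exact dvd_add (Dvd.dvd.mul_right hg _) (Dvd.dvd.mul_left hh _)
  inv_mem' := by
    intro g hg
    show (4 : ℤ_[2]) ∣ g⁻¹ 1 0
    rw [Matrix.SpecialLinearGroup.SL2_inv_expl]
    simpa using hg

/-- `K₀`, the inverse image of `{c ∈ 4ℤ₂} ⊆ SL₂(ℤ₂)`. -/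
noncomputable def K₀ : Subgroup K := Γ₀4.comap prZ

/-- `K₁`, the set of `(g, 1)` with `g` in `SL₂(ℤ₂)`, `a ∈ 1 + 4ℤ₂` and `c ∈ 4ℤ₂`. -/
def K₁ : Set K := {k | k.1.sign = 1 ∧ 4 ∣ prZ k 0 0 - 1 ∧ 4 ∣ prZ k 1 0}

/-- The principal congruence subgroup of level `2 ^ n` in `SL₂(ℤ₂)`. -/
noncomputable def Γ (n : ℕ) : Subgroup SLZ :=
  (Matrix.SpecialLinearGroup.map (n := Fin 2) (PadicInt.toZModPow (p := 2) n)).ker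

instance (n : ℕ) : (Γ n).Normal := by unfold Γ; infer_instance

theorem mem_Γ {n : ℕ} {g : SLZ} :
    g ∈ Γ n ↔ ∀ i j, PadicInt.toZModPow n (g i j) = (1 : Matrix (Fin 2) (Fin 2) (ZMod (2 ^ n))) i j := by
  rw [Γ, MonoidHom.mem_ker, Matrix.SpecialLinearGroup.ext_iff]
  rfl

theorem mem_Γ' {n : ℕ} {g : SLZ} :
    g ∈ Γ n ↔ ∀ i j, (2 : ℤ_[2]) ^ n ∣ g i j - (1 : Matrix (Fin 2) (Fin 2) ℤ_[2]) i j := by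
  rw [mem_Γ]
  refine forall_congr' fun i => forall_congr' fun j => ?_
  have : (1 : Matrix (Fin 2) (Fin 2) (ZMod (2 ^ n))) i j =
      PadicInt.toZModPow n ((1 : Matrix (Fin 2) (Fin 2) ℤ_[2]) i j) := by
    rw [Matrix.one_apply, Matrix.one_apply]; split_ifs <;> simp
  rw [this, ← sub_eq_zero, ← map_sub, ← RingHom.mem_ker, PadicInt.ker_toZModPow,
    Ideal.mem_span_singleton]
  simp

theorem Γ_anti {m n : ℕ} (h : m ≤ n) : Γ n ≤ Γ m := fun g hg => by
  rw [mem_Γ'] at *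
  exact fun i j => (pow_dvd_pow 2 h).trans (hg i j)

theorem sigma_eq_one {g h : SLQ} {t u v : ℚ_[2]} (ht : g 1 1 = t ^ 2) (hu : h 0 0 = u ^ 2) (u0 : h 0 0 ≠ 0)
    (hv : h 1 1 = v ^ 2) {w : ℚ_[2]} (hw : (g * h) 1 1 = w ^ 2) : sigma g h = 1 := by
  have hs : ∀ {k : SLQ} {z : ℚ_[2]}, k 1 1 = z ^ 2 → sfun k = 1 := by
    intro k z hz
    unfold sfun
    split_ifs
    · rw [hz, hilbertSymbol.comm, hilbertSymbol.sq_left]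
    · rfl
  rw [sigma, hs ht, hs hv, hs hw, mul_one, mul_one, mul_one]
  have a12 := sigma.mul10 g h
  by_cases c1 : g 1 0 = 0
  · rw [sigma.xfun_mul_left c1, sigma.xfun_of_eq c1, ht, hilbertSymbol.comm]
    rw [show t ^ 2 * xfun h * xfun h = (t * xfun h) ^ 2 by ring, hilbertSymbol.sq_left]
  by_cases c2 : h 1 0 = 0
  · obtain ⟨r, r0, hr⟩ := sigma.xfun_mul_right c2 g
    rw [hr, sigma.xfun_of_eq c2, hv]
    rw [show xfun g * v ^ 2 * (r * r) * xfun g = (xfun g * v * r) ^ 2 by ring,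
      hilbertSymbol.sq_left]
  by_cases c12 : (g * h) 1 0 = 0
  · rw [sigma.xfun_of_eq c12, sigma.xfun_of_ne c1, sigma.xfun_of_ne c2, hw]
    refine hilbertSymbol.eq_one u t 0 (Or.inl ?_) ?_
    · rintro rfl; simp [hu] at u0
    · rw [c12, hu, ht] at a12
      linear_combination w ^ 2 * a12
  · rw [sigma.xfun_of_ne c12, sigma.xfun_of_ne c1, sigma.xfun_of_ne c2]
    refine hilbertSymbol.eq_one u t ((g * h) 1 0) (by tauto) ?_
    rw [hu, ht] at a12
    linear_combination (g * h) 1 0 * a12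

theorem diag_sq {g : SLZ} (hg : g ∈ Γ 3) (i : Fin 2) :
    toQ g i i ≠ 0 ∧ ∃ t : ℚ_[2], toQ g i i = t ^ 2 := by
  have h := mem_Γ.1 hg i i
  rw [Matrix.one_apply_eq] at h
  obtain ⟨w, hw⟩ := hilbertSymbol.isSquare_of_mod_eight h
  rw [toQ_apply, hw]
  refine ⟨?_, w, by push_cast; rfl⟩
  intro h0
  rw [PadicInt.coe_eq_zero] at h0
  rw [hw, h0, map_zero] at h
  exact absurd h (by decide)

theorem sigma_Γ {g h : SLZ} (hg : g ∈ Γ 3) (hh : h ∈ Γ 3) : sigma (toQ g) (toQ h) = 1 := by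
  obtain ⟨-, t, ht⟩ := diag_sq hg 1
  obtain ⟨u0, u, hu⟩ := diag_sq hh 0
  obtain ⟨-, v, hv⟩ := diag_sq hh 1
  obtain ⟨-, w, hw⟩ := diag_sq (mul_mem hg hh) 1
  exact sigma_eq_one ht hu u0 hv (by rw [← map_mul]; exact hw)

/-- The image of the principal congruence subgroup of level `2 ^ (n + 3)` under the section `𝐬`. -/
noncomputable def U (n : ℕ) : Subgroup K where
  carrier := {k | prZ k ∈ Γ (n + 3) ∧ k.1.sign = 1}
  one_mem' := ⟨by rw [map_one]; exact one_mem _, rfl⟩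
  mul_mem' := by
    rintro k l ⟨hk, hk'⟩ ⟨hl, hl'⟩
    refine ⟨by rw [map_mul]; exact mul_mem hk hl, ?_⟩
    rw [sign_mul, hk', hl', sigma_Γ (Γ_anti (by omega) hk) (Γ_anti (by omega) hl)]; rfl
  inv_mem' := by
    rintro k ⟨hk, hk'⟩
    have hi : prZ k⁻¹ ∈ Γ (n + 3) := by rw [map_inv]; exact inv_mem hk
    refine ⟨hi, ?_⟩
    rw [sign_inv, hk', sigma_Γ (Γ_anti (by omega) hk) (Γ_anti (by omega) hi)]; rfl

theorem mem_U {n : ℕ} {k : K} : k ∈ U n ↔ prZ k ∈ Γ (n + 3) ∧ k.1.sign = 1 := Iff.rfl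

theorem U_anti {m n : ℕ} (h : m ≤ n) : U n ≤ U m := fun _ hk =>
  ⟨Γ_anti (by omega) hk.1, hk.2⟩

/-- Elements close to the identity are squares of elements close to the identity. -/
theorem exists_sqrt {g : SLZ} (hg : g ∈ Γ 5) : ∃ w ∈ Γ 3, w * w = g := by
  have hg' := mem_Γ'.1 hg
  choose x hx using hg'
  have hdet : g 0 0 * g 1 1 - g 0 1 * g 1 0 = 1 := by
    rw [← Matrix.det_fin_two, g.det_coe]
  have e00 : g 0 0 = 1 + 32 * x 0 0 := by have := hx 0 0; simp at this; linear_combination this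
  have e01 : g 0 1 = 32 * x 0 1 := by have := hx 0 1; simp at this; linear_combination this
  have e10 : g 1 0 = 32 * x 1 0 := by have := hx 1 0; simp at this; linear_combination this
  have e11 : g 1 1 = 1 + 32 * x 1 1 := by have := hx 1 1; simp at this; linear_combination this
  rw [e00, e01, e10, e11] at hdet
  generalize x 0 0 = a at *
  generalize x 0 1 = b at *
  generalize x 1 0 = c at *
  generalize x 1 1 = d at *
  have htr : a + d = -32 * (a * d - b * c) := by
    have h32 : (32 : ℤ_[2]) ≠ 0 := by norm_num
    apply mul_left_cancel₀ h32
    linear_combination hdet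
  have hunit : IsUnit (1 - 256 * (a * d - b * c)) := by
    by_contra hn
    rw [PadicInt.not_isUnit_iff] at hn
    have h2 : ‖256 * (a * d - b * c)‖ < 1 := by
      rw [show (256 : ℤ_[2]) * (a * d - b * c) = ((2 : ℕ) : ℤ_[2]) * (128 * (a * d - b * c)) by
        push_cast; ring, PadicInt.norm_lt_one_iff_dvd]
      exact dvd_mul_right _ _
    have := PadicInt.norm_lt_one_add hn h2
    rw [sub_add_cancel] at this
    simp at this
  obtain ⟨e, he⟩ := hunit.exists_right_inv
  have z16 : PadicInt.toZModPow (p := 2) 4 256 = 0 := by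
    have : PadicInt.toZModPow (p := 2) 4 (256 : ℕ) = ((256 : ℕ) : ZMod (2 ^ 4)) := map_natCast _ _
    have h0 : ((256 : ℕ) : ZMod (2 ^ 4)) = 0 := by decide
    rw [h0] at this
    exact_mod_cast this
  have e16 : PadicInt.toZModPow (p := 2) 4 e = 1 := by
    have := congrArg (PadicInt.toZModPow (p := 2) 4) he
    rw [map_mul, map_sub, map_mul, z16, map_one, zero_mul, sub_zero, one_mul] at this
    exact this
  have e8 : PadicInt.toZModPow (p := 2) 3 e = 1 := by
    rw [← PadicInt.cast_toZModPow 3 4 (by norm_num), e16]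
    rfl
  obtain ⟨r, hr⟩ := hilbertSymbol.isSquare_of_mod_eight e8
  obtain ⟨r, hr, hr8⟩ : ∃ r : ℤ_[2], e = r ^ 2 ∧ PadicInt.toZModPow (p := 2) 3 r = 1 := by
    have key : ∀ z : ZMod 16, z ^ 2 = 1 → (ZMod.cast z : ZMod 8) = 1 ∨ (ZMod.cast z : ZMod 8) = -1 := by
      decide
    have h2 : (PadicInt.toZModPow (p := 2) 4 r) ^ 2 = 1 := by rw [← map_pow, ← hr, e16]
    rcases key _ h2 with h | h
    · exact ⟨r, hr, by rw [← PadicInt.cast_toZModPow 3 4 (by norm_num)]; exact h⟩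
    · refine ⟨-r, by rw [hr]; ring, ?_⟩
      rw [map_neg, ← PadicInt.cast_toZModPow 3 4 (by norm_num)]
      have := congrArg (fun z => -z) h
      rw [neg_neg] at this
      exact this
  have hR : r ^ 2 * (1 - 256 * (a * d - b * c)) = 1 := by rw [← hr, mul_comm]; exact he
  have z8 : PadicInt.toZModPow (p := 2) 3 16 = 0 := by
    have : PadicInt.toZModPow (p := 2) 3 (16 : ℕ) = ((16 : ℕ) : ZMod (2 ^ 3)) := map_natCast _ _
    have h0 : ((16 : ℕ) : ZMod (2 ^ 3)) = 0 := by decide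
    rw [h0] at this
    exact_mod_cast this
  have hdetw : Matrix.det !![r * (1 + 16 * a), r * (16 * b); r * (16 * c), r * (1 + 16 * d)] = 1 := by
    rw [Matrix.det_fin_two_of]
    linear_combination hR + 16 * r ^ 2 * htr
  obtain ⟨w, hw⟩ : ∃ w : SLZ, (w : Matrix (Fin 2) (Fin 2) ℤ_[2]) =
      !![r * (1 + 16 * a), r * (16 * b); r * (16 * c), r * (1 + 16 * d)] := ⟨⟨_, hdetw⟩, rfl⟩
  refine ⟨w, ?_, ?_⟩
  · rw [mem_Γ, hw]
    intro i j
    fin_cases i <;> fin_cases j <;>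
      simp [map_mul, map_add, hr8, z8]
  · ext i j
    rw [Matrix.SpecialLinearGroup.coe_mul, hw]
    fin_cases i <;> fin_cases j
    · simp [Matrix.mul_apply, Fin.sum_univ_two, e00]
      linear_combination (1 + 32 * a) * hR + 256 * r ^ 2 * a * htr
    · simp [Matrix.mul_apply, Fin.sum_univ_two, e01]
      linear_combination (32 * b) * hR + 256 * r ^ 2 * b * htr
    · simp [Matrix.mul_apply, Fin.sum_univ_two, e10]
      linear_combination (32 * c) * hR + 256 * r ^ 2 * c * htr
    · simp [Matrix.mul_apply, Fin.sum_univ_two, e11]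
      linear_combination (1 + 32 * d) * hR + 256 * r ^ 2 * d * htr

theorem conj_mem_U (n : ℕ) (k : K) {v : K} (hv : v ∈ U (n + 2)) : k * v * k⁻¹ ∈ U n := by
  have hG : prZ (k * v * k⁻¹) ∈ Γ (n + 2 + 3) := by
    rw [map_mul, map_mul, map_inv]
    exact (inferInstance : (Γ (n + 2 + 3)).Normal).conj_mem _ hv.1 _
  refine ⟨Γ_anti (by omega) hG, ?_⟩
  obtain ⟨w, hw, hww⟩ := exists_sqrt (Γ_anti (show 5 ≤ n + 2 + 3 by omega) hv.1)
  have hvv : v = mkK w 1 * mkK w 1 := by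
    apply K_ext
    · rw [map_mul, prZ_mkK, hww]
    · rw [sign_mul, prZ_mkK, sigma_Γ hw hw, hv.2]; rfl
  have hc : k * v * k⁻¹ = (k * mkK w 1 * k⁻¹) * (k * mkK w 1 * k⁻¹) := by rw [hvv]; group
  have hm : prZ (k * mkK w 1 * k⁻¹) ∈ Γ 3 := by
    rw [map_mul, map_mul, map_inv, prZ_mkK]
    exact (inferInstance : (Γ 3).Normal).conj_mem _ hw _
  rw [hc, sign_mul, sigma_Γ hm hm, mul_one]
  exact Int.units_mul_self _

/-- The images under the section of the principal congruence subgroups form a basis of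
neighbourhoods of the identity in `K`. -/
noncomputable abbrev basisK : GroupFilterBasis K where
  sets := Set.range fun n => (U n : Set K)
  nonempty := ⟨_, 0, rfl⟩
  inter_sets := by
    rintro _ _ ⟨m, rfl⟩ ⟨n, rfl⟩
    exact ⟨_, ⟨max m n, rfl⟩, fun k hk =>
      ⟨U_anti (le_max_left m n) hk, U_anti (le_max_right m n) hk⟩⟩
  one' := by rintro _ ⟨n, rfl⟩; exact one_mem (U n)
  mul' := by
    rintro _ ⟨n, rfl⟩
    refine ⟨_, ⟨n, rfl⟩, ?_⟩
    rintro _ ⟨a, ha, b, hb, rfl⟩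
    exact (U n).mul_mem ha hb
  inv' := by
    rintro _ ⟨n, rfl⟩
    exact ⟨_, ⟨n, rfl⟩, fun a ha => (U n).inv_mem ha⟩
  conj' := by
    rintro k _ ⟨n, rfl⟩
    exact ⟨_, ⟨n + 2, rfl⟩, fun v hv => conj_mem_U n k hv⟩

/-- The topology of `K`. -/
noncomputable instance : TopologicalSpace K := basisK.topology

instance : IsTopologicalGroup K := basisK.isTopologicalGroup

theorem U_mem_nhds (n : ℕ) : (U n : Set K) ∈ nhds (1 : K) :=
  basisK.mem_nhds_one ⟨n, rfl⟩

theorem isOpen_U (n : ℕ) : IsOpen (U n : Set K) := (U n).isOpen_of_mem_nhds (U_mem_nhds n)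

end Cover

namespace Cover

theorem isOpen_dvd (n : ℕ) (a : ℤ_[2]) : IsOpen {x : ℤ_[2] | (2 : ℤ_[2]) ^ n ∣ x - a} := by
  have : {x : ℤ_[2] | (2 : ℤ_[2]) ^ n ∣ x - a} = {x | ‖x - a‖ < (2 : ℝ) ^ (-(n : ℤ) + 1)} := by
    ext x
    have h := PadicInt.norm_le_pow_iff_norm_lt_pow_add_one (p := 2) (x - a) (-(n : ℤ))
    have h' := PadicInt.norm_le_pow_iff_mem_span_pow (p := 2) (x - a) n
    rw [Ideal.mem_span_singleton] at h'
    push_cast at h h'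
    exact h'.symm.trans h
  rw [this]
  exact isOpen_lt (by fun_prop) (by fun_prop)

theorem isOpen_Γ (n : ℕ) : IsOpen (Γ n : Set SLZ) := by
  have : (Γ n : Set SLZ) = ⋂ i, ⋂ j, (fun g : SLZ => (g : Matrix (Fin 2) (Fin 2) ℤ_[2]) i j) ⁻¹'
      {x | (2 : ℤ_[2]) ^ n ∣ x - (1 : Matrix (Fin 2) (Fin 2) ℤ_[2]) i j} := by
    ext g
    simp only [SetLike.mem_coe, mem_Γ', Set.mem_iInter, Set.mem_preimage, Set.mem_ofPred_eq]
  rw [this]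
  refine isOpen_iInter_of_finite fun i => isOpen_iInter_of_finite fun j => ?_
  exact (isOpen_dvd n _).preimage
    (Matrix.SpecialLinearGroup.isClosedEmbedding_val.continuous.matrix_elem i j)

instance : CompactSpace SLZ := by
  have : CompactSpace (Matrix (Fin 2) (Fin 2) ℤ_[2]) :=
    inferInstanceAs (CompactSpace (Fin 2 → Fin 2 → ℤ_[2]))
  exact Matrix.SpecialLinearGroup.isClosedEmbedding_val.compactSpace

/-- The section `𝐬` on the principal congruence subgroup of level `8`. -/
noncomputable def secΓ : Γ 3 →* K where
  toFun u := mkK u.1 1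
  map_one' := K_ext (by rw [prZ_mkK, map_one]; rfl) rfl
  map_mul' u v := by
    apply K_ext
    · rw [map_mul, prZ_mkK, prZ_mkK, prZ_mkK]; rfl
    · rw [sign_mul, prZ_mkK, prZ_mkK, sigma_Γ u.2 v.2]; rfl

theorem continuous_secΓ : Continuous secΓ := by
  apply continuous_of_continuousAt_one
  rw [ContinuousAt, map_one]
  rw [(basisK.nhds_one_hasBasis).tendsto_right_iff]
  rintro _ ⟨n, rfl⟩
  have ho : IsOpen ((Γ (n + 3) : Set SLZ)) := isOpen_Γ _
  have : ((fun u : Γ 3 => (u : SLZ)) ⁻¹' (Γ (n + 3) : Set SLZ)) ∈ nhds (1 : Γ 3) :=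
    (ho.preimage continuous_subtype_val).mem_nhds (one_mem (Γ (n + 3)))
  filter_upwards [this] with u hu
  exact ⟨by rw [show prZ (secΓ u) = u.1 from prZ_mkK _ _]; exact hu, rfl⟩

theorem isCompact_U : IsCompact (U 0 : Set K) := by
  have hc : CompactSpace (Γ 3) := isCompact_iff_compactSpace.1
    ((Γ 3).isClosed_of_isOpen (isOpen_Γ 3)).isCompact
  have : (U 0 : Set K) = Set.range secΓ := by
    ext k
    constructor
    · rintro ⟨h, h'⟩
      exact ⟨⟨prZ k, h⟩, K_ext (prZ_mkK _ _) h'.symm⟩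
    · rintro ⟨u, rfl⟩
      exact ⟨by rw [show prZ (secΓ u) = u.1 from prZ_mkK _ _]; exact u.2, rfl⟩
  rw [this]
  exact isCompact_range continuous_secΓ

instance : CompactSpace K := by
  constructor
  have hfin : Finite (K ⧸ (Γ 3).comap prZ) := by
    have : ((Γ 3).comap prZ).FiniteIndex := by
      rw [Γ, MonoidHom.comap_ker]; infer_instance
    exact Subgroup.finite_quotient_of_finiteIndex
  have : (Set.univ : Set K) = ⋃ q : K ⧸ (Γ 3).comap prZ,
      ((fun u => q.out * u) '' (U 0 : Set K) ∪ (fun u => q.out * mkK 1 (-1) * u) '' (U 0 : Set K)) := by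
    symm
    rw [Set.eq_univ_iff_forall]
    intro k
    rw [Set.mem_iUnion]
    refine ⟨(k : K ⧸ (Γ 3).comap prZ), ?_⟩
    set q := (k : K ⧸ (Γ 3).comap prZ).out with hq
    have hm : q⁻¹ * k ∈ (Γ 3).comap prZ := QuotientGroup.eq.1 (QuotientGroup.out_eq' _)
    rcases Int.units_eq_one_or (q⁻¹ * k).1.sign with h | h
    · left
      exact ⟨q⁻¹ * k, ⟨hm, h⟩, by group⟩
    · right
      refine ⟨(mkK 1 (-1))⁻¹ * (q⁻¹ * k), ⟨?_, ?_⟩, by group⟩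
      · rw [map_mul, map_inv, prZ_mkK, inv_one, one_mul]; exact hm
      · rw [sign_mul, h, map_inv, prZ_mkK, inv_one, map_one, sigma.one_left, sign_inv, prZ_mkK,
          map_one, sigma.one_left]
        simp [mkK]
  rw [this]
  exact isCompact_iUnion fun q => (isCompact_U.image (continuous_const_mul _)).union
    (isCompact_U.image (continuous_const_mul _))

noncomputable instance : MeasurableSpace K := borel K
instance : BorelSpace K := ⟨rfl⟩

theorem U_le_K₀ : U 0 ≤ K₀ := by
  rintro k ⟨h, -⟩
  have := mem_Γ'.1 h 1 0
  show (4 : ℤ_[2]) ∣ prZ k 1 0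
  rw [Matrix.one_apply_ne (by decide), sub_zero] at this
  exact dvd_trans ⟨2, by norm_num⟩ this

theorem isOpen_K₀ : IsOpen (K₀ : Set K) :=
  K₀.isOpen_of_mem_nhds (Filter.mem_of_superset (U_mem_nhds 0) U_le_K₀)

/-- `K₀` as a compact set with non-empty interior. -/
noncomputable def compactK₀ : TopologicalSpace.PositiveCompacts K where
  carrier := K₀
  isCompact' := (K₀.isClosed_of_isOpen isOpen_K₀).isCompact
  interior_nonempty' := ⟨1, by rw [isOpen_K₀.interior_eq]; exact one_mem K₀⟩

/-- The Haar measure `dk` of `K`, normalised so that `K₀` has measure `1`. -/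
noncomputable def haarK : MeasureTheory.Measure K := MeasureTheory.Measure.haarMeasure compactK₀

noncomputable instance : haarK.IsHaarMeasure := by unfold haarK; infer_instance

end Cover

namespace Cover

/-- A genuine character `γ` of the centre `M = {±1} × μ₂` of `G`, extended to `K₀ = M × K₁`
so that it is trivial on `K₁`. -/
structure GenuineChar where
  /-- the character of `K₀` -/
  toHom : K₀ →* ℂˣ
  trivial_K₁ : ∀ k : K₀, (k : K) ∈ K₁ → toHom k = 1
  genuine : ∀ k : K₀, (k : K) = mkK 1 (-1) → toHom k = -1

/-- The value of `γ` as a complex number. -/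
noncomputable def GenuineChar.val (γ : GenuineChar) (k : K₀) : ℂ := (γ.toHom k : ℂ)

/-- The complex conjugate character `γ̄`. -/
noncomputable def GenuineChar.conj (γ : GenuineChar) : GenuineChar where
  toHom := (Units.map (starRingEnd ℂ : ℂ →* ℂ)).comp γ.toHom
  trivial_K₁ k hk := by simp [γ.trivial_K₁ k hk]
  genuine k hk := by
    rw [MonoidHom.comp_apply, γ.genuine k hk]; ext; simp

/-- `h(-1)`, as an element of `K₀`. -/
noncomputable def hNeg : K₀ := ⟨mkK (-1) 1, by
  show (4 : ℤ_[2]) ∣ prZ (mkK (-1) 1) 1 0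
  rw [prZ_mkK]; simp⟩

/-- The matrix of `w(1)`. -/
noncomputable def wMat : SLZ := ⟨!![0, 1; -1, 0], by simp [Matrix.det_fin_two]⟩

/-- `w = w(1)`, as an element of `K`. -/
noncomputable def w : K := mkK wMat 1

section wellDefined

theorem wMat_coe : (wMat : Matrix (Fin 2) (Fin 2) ℤ_[2]) = !![0, 1; -1, 0] := rfl

theorem hilbert_unit {a v : ℤ_[2]} (ha : 4 ∣ a - 1) (hv : IsUnit v) :
    hilbertSymbol (a : ℚ_[2]) (v : ℚ_[2]) = 1 := by
  have key : ∀ x y k : ZMod 8, (∃ e, y * e = 1) → x - 1 = 4 * k → x = 1 ∨ x + 4 * y = 1 := by decide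
  obtain ⟨k, hk⟩ := ha
  have hk' := congrArg (PadicInt.toZModPow (p := 2) 3) hk
  have h4 : PadicInt.toZModPow (p := 2) 3 4 = 4 := map_ofNat _ 4
  rw [map_sub, map_one, map_mul, h4] at hk'
  rcases key _ _ _ (isUnit_iff_exists_inv.1 (hv.map (PadicInt.toZModPow (p := 2) 3))) hk' with h | h
  · obtain ⟨r, hr⟩ := hilbertSymbol.isSquare_of_mod_eight h
    rw [hr, PadicInt.coe_pow, hilbertSymbol.sq_left]
  · have : PadicInt.toZModPow (p := 2) 3 (a + 4 * v) = 1 := by rw [map_add, map_mul, h4]; exact h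
    obtain ⟨r, hr⟩ := hilbertSymbol.isSquare_of_mod_eight this
    refine hilbertSymbol.eq_one 1 2 r (by simp) ?_
    have := congrArg (fun z : ℤ_[2] => (z : ℚ_[2])) hr
    simp only [PadicInt.coe_add, PadicInt.coe_mul, PadicInt.coe_pow] at this
    rw [← this]
    have h4 : ((4 : ℤ_[2]) : ℚ_[2]) = 4 := rfl
    rw [h4]; ring

theorem sign_aux {v : SLQ} {a : ℤ_[2]} (ha : 4 ∣ a - 1) (a0 : (a : ℚ_[2]) ≠ 0) {t : ℚ_[2]}
    (ht : t ≠ 0) (hv : v 1 1 = a * t ^ 2) :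
    hilbertSymbol (a : ℚ_[2]) (-a * xfun v) * sfun v = 1 := by
  by_cases c : v 1 0 = 0
  · rw [sigma.xfun_of_eq c, hv]
    have hs : sfun v = 1 := by simp [sfun, c]
    have : -(a : ℚ_[2]) * (a * t ^ 2) = ((-1 : ℤ_[2]) : ℚ_[2]) * (a * t) ^ 2 := by push_cast; ring
    rw [hs, mul_one, this, hilbertSymbol.mul_sq_right _ _ (mul_ne_zero a0 ht),
      hilbert_unit ha (by simp)]
  · have h1 : hilbertSymbol (a : ℚ_[2]) (-a * xfun v) = hilbertSymbol (a : ℚ_[2]) (v 1 0) := by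
      rw [sigma.xfun_of_ne c, hilbertSymbol.mul_right a0 (neg_ne_zero.2 a0) c,
        hilbertSymbol.self_neg, one_mul]
    rw [h1, sfun]
    have hd : v 1 1 ≠ 0 := by rw [hv]; exact mul_ne_zero a0 (pow_ne_zero _ ht)
    by_cases hodd : Odd (v 1 0).valuation
    · rw [if_pos ⟨mul_ne_zero c hd, hodd⟩, hv, hilbertSymbol.mul_sq_right _ _ ht,
        hilbertSymbol.comm (v 1 0)]
      exact Int.units_mul_self _
    · rw [if_neg (fun h => hodd h.2), mul_one]
      rw [Int.not_odd_iff_even] at hodd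
      obtain ⟨m, hm⟩ := hodd
      have two : (2 : ℚ_[2]) ≠ 0 := by norm_num
      have hu : ‖v 1 0 * (2 : ℚ_[2]) ^ (-(m + m))‖ = 1 := by
        rw [norm_mul, Padic.norm_eq_zpow_neg_valuation c, norm_zpow]
        have : ‖(2 : ℚ_[2])‖ = (2 : ℝ)⁻¹ := by simpa using Padic.norm_p (p := 2)
        rw [this, inv_zpow', Nat.cast_ofNat, ← zpow_add₀ (by norm_num)]
        simp [hm]
      have he : v 1 0 = (((⟨_, hu.le⟩ : ℤ_[2]) : ℤ_[2]) : ℚ_[2]) * ((2 : ℚ_[2]) ^ m) ^ 2 := by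
        show v 1 0 = (v 1 0 * (2 : ℚ_[2]) ^ (-(m + m))) * ((2 : ℚ_[2]) ^ m) ^ 2
        rw [zpow_neg, zpow_add₀ two]; field_simp
      rw [he, hilbertSymbol.mul_sq_right _ _ (zpow_ne_zero _ two)]
      exact hilbert_unit ha (PadicInt.isUnit_iff.2 hu)

theorem z_mem_K₀ (ε : ℤˣ) : mkK 1 ε ∈ K₀ := by
  show (4 : ℤ_[2]) ∣ prZ (mkK 1 ε) 1 0
  rw [prZ_mkK]; simp

theorem char_eq (γ : GenuineChar) (k : K₀) (h : 4 ∣ prZ k 0 0 - 1) :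
    γ.toHom k = γ.toHom ⟨mkK 1 (k : K).1.sign, z_mem_K₀ _⟩ := by
  have hk : (4 : ℤ_[2]) ∣ prZ k 1 0 := k.2
  have hm : mkK (prZ k) 1 ∈ K₀ := by
    show (4 : ℤ_[2]) ∣ prZ (mkK (prZ k) 1) 1 0
    rw [prZ_mkK]; exact hk
  have e : k = ⟨mkK 1 (k : K).1.sign, z_mem_K₀ _⟩ * ⟨mkK (prZ k) 1, hm⟩ := by
    apply Subtype.ext
    apply K_ext
    · show prZ k = prZ (mkK 1 (k : K).1.sign * mkK (prZ k) 1)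
      rw [map_mul, prZ_mkK, prZ_mkK, one_mul]
    · show (k : K).1.sign = (mkK 1 (k : K).1.sign * mkK (prZ k) 1).1.sign
      rw [sign_mul, prZ_mkK, map_one, sigma.one_left]
      simp [mkK]
  have h1 : γ.toHom ⟨mkK (prZ k) 1, hm⟩ = 1 := by
    apply γ.trivial_K₁
    refine ⟨rfl, ?_, ?_⟩ <;> simp only [prZ_mkK]
    · exact h
    · exact hk
  conv_lhs => rw [e]
  rw [map_mul, h1, mul_one]

theorem xfun_w : xfun (toQ wMat) = -1 := by
  have : toQ wMat 1 0 = -1 := by rw [toQ_apply]; simp [wMat]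
  rw [sigma.xfun_of_ne (by rw [this]; norm_num), this]

theorem sfun_w : sfun (toQ wMat) = 1 := by
  have : toQ wMat 1 1 = 0 := by rw [toQ_apply]; simp [wMat]
  simp [sfun, this]

theorem conj_w_aux (γ : GenuineChar) {m n : K₀} (h : (m : K) * w = w * n)
    (ha : 4 ∣ prZ (n : K) 0 0 - 1) : γ.toHom m = γ.toHom n := by
  have hm : (4 : ℤ_[2]) ∣ prZ m 1 0 := m.2
  have hn : (4 : ℤ_[2]) ∣ prZ n 1 0 := n.2
  have hM : prZ m * wMat = wMat * prZ n := by
    have := congrArg prZ h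
    rwa [map_mul, map_mul, show prZ w = wMat from prZ_mkK _ _] at this
  have hS : (m : K).1.sign * sigma (toQ (prZ m)) (toQ wMat) =
      (n : K).1.sign * sigma (toQ wMat) (toQ (prZ n)) := by
    have := congrArg (fun k : K => k.1.sign) h
    simp only [sign_mul] at this
    rw [show prZ w = wMat from prZ_mkK _ _, show w.1.sign = 1 from rfl, mul_one, one_mul] at this
    exact this
  have E : ∀ i j, (prZ m * wMat) i j = (wMat * prZ n) i j := fun i j => by rw [hM]
  simp only [Matrix.SpecialLinearGroup.coe_mul, wMat_coe] at E
  have E00 := E 0 0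
  have E01 := E 0 1
  have E10 := E 1 0
  have E11 := E 1 1
  simp [Matrix.mul_apply, Fin.sum_univ_two] at E00 E01 E10 E11
  have hdet : prZ (n : K) 0 0 * prZ (n : K) 1 1 - prZ (n : K) 0 1 * prZ (n : K) 1 0 = 1 := by
    rw [← Matrix.det_fin_two, (prZ (n : K)).det_coe]
  rw [E11] at hm
  obtain ⟨b, hb⟩ := (dvd_neg.1 hm)
  obtain ⟨c, hc⟩ := hn
  have hd : (4 : ℤ_[2]) ∣ prZ (n : K) 1 1 - 1 := by
    obtain ⟨e, he⟩ := ha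
    rw [hb, hc] at hdet
    refine ⟨4 * b * c - e * prZ (n : K) 1 1, ?_⟩
    linear_combination hdet - prZ (n : K) 1 1 * he
  have hsq : PadicInt.toZModPow (p := 2) 3 (prZ (n : K) 0 0 * prZ (n : K) 1 1) = 1 := by
    have z16 : PadicInt.toZModPow (p := 2) 3 16 = 0 := by
      have : PadicInt.toZModPow (p := 2) 3 16 = 16 := map_ofNat _ 16
      rw [this]; decide
    have : prZ (n : K) 0 0 * prZ (n : K) 1 1 = 1 + 16 * (b * c) := by
      rw [hb, hc] at hdet; linear_combination hdet
    rw [this, map_add, map_mul, z16, map_one, zero_mul, add_zero]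
  obtain ⟨r, hr⟩ := hilbertSymbol.isSquare_of_mod_eight hsq
  have hr' : ((prZ (n : K) 0 0 : ℤ_[2]) : ℚ_[2]) * ((prZ (n : K) 1 1 : ℤ_[2]) : ℚ_[2]) =
      (r : ℚ_[2]) ^ 2 := by
    have := congrArg (fun z : ℤ_[2] => (z : ℚ_[2])) hr
    simpa only [PadicInt.coe_mul, PadicInt.coe_pow] using this
  have hru : IsUnit (prZ (n : K) 0 0 * prZ (n : K) 1 1) := by
    by_contra hcon
    rw [PadicInt.not_isUnit_iff] at hcon
    have h2 : ‖-(prZ (n : K) 0 1 * prZ (n : K) 1 0)‖ < 1 := by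
      rw [hb, norm_neg, show 4 * b * prZ (n : K) 1 0 =
        ((2 : ℕ) : ℤ_[2]) * (2 * b * prZ (n : K) 1 0) by push_cast; ring,
        PadicInt.norm_lt_one_iff_dvd]
      exact dvd_mul_right _ _
    have := PadicInt.norm_lt_one_add hcon h2
    rw [← sub_eq_add_neg, hdet] at this
    simp at this
  have hu : IsUnit (prZ (n : K) 0 0) := isUnit_of_mul_isUnit_left hru
  have a0 : ((prZ (n : K) 0 0 : ℤ_[2]) : ℚ_[2]) ≠ 0 := PadicInt.coe_ne_zero.2 hu.ne_zero
  have r0 : (r : ℚ_[2]) ≠ 0 := by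
    rw [hr] at hru
    exact PadicInt.coe_ne_zero.2 (right_ne_zero_of_mul (by rw [← sq]; exact hru.ne_zero))
  have s1 := sign_aux (v := toQ (prZ (n : K))) ha a0 (div_ne_zero r0 a0) (by
    rw [toQ_apply]; field_simp; linear_combination hr')
  have s2 := sign_aux (v := toQ (prZ (m : K))) ha a0 one_ne_zero (by
    rw [toQ_apply, E10]; ring)
  have p10 : toQ (wMat * prZ (n : K)) 1 0 = -((prZ (n : K) 0 0 : ℤ_[2]) : ℚ_[2]) := by
    rw [toQ_apply, Matrix.SpecialLinearGroup.coe_mul, wMat_coe]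
    simp [Matrix.mul_apply, Fin.sum_univ_two]
  have px : xfun (toQ (wMat * prZ (n : K))) = -((prZ (n : K) 0 0 : ℤ_[2]) : ℚ_[2]) := by
    rw [sigma.xfun_of_ne (by rw [p10]; exact neg_ne_zero.2 a0), p10]
  have ps : sfun (toQ (wMat * prZ (n : K))) = 1 := by
    unfold sfun
    rw [if_neg]
    rintro ⟨-, hodd⟩
    rw [p10] at hodd
    have hn : ‖-((prZ (n : K) 0 0 : ℤ_[2]) : ℚ_[2])‖ = 1 := by
      rw [norm_neg]; exact PadicInt.isUnit_iff.1 hu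
    rw [Padic.norm_eq_zpow_neg_valuation (neg_ne_zero.2 a0),
      zpow_eq_one_iff_right₀ (by norm_num) (by norm_num)] at hn
    rw [neg_eq_zero] at hn
    rw [hn] at hodd
    exact absurd hodd (by decide)
  have t1 : sigma (toQ wMat) (toQ (prZ (n : K))) = 1 := by
    rw [sigma, ← map_mul, px, ps, xfun_w, sfun_w, mul_one, mul_one, mul_neg_one, neg_neg]
    exact s1
  have t2 : sigma (toQ (prZ (m : K))) (toQ wMat) = 1 := by
    rw [sigma, ← map_mul, hM, px, ps, xfun_w, sfun_w, mul_one, mul_one, mul_neg_one, neg_neg,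
      hilbertSymbol.comm]
    exact s2
  rw [t1, t2, mul_one, mul_one] at hS
  rw [char_eq γ n ha, char_eq γ m (by rw [E01]; exact hd)]
  congr 3

theorem four_dvd_or {a d b : ℤ_[2]} (h : a * d - 4 * b = 1) : 4 ∣ a - 1 ∨ 4 ∣ -a - 1 := by
  have key : ∀ x y : ZMod 4, x * y = 1 → x = 1 ∨ -x = 1 := by decide
  have back : ∀ z : ℤ_[2], PadicInt.toZModPow (p := 2) 2 z = 1 → 4 ∣ z - 1 := by
    intro z hz
    have : z - 1 ∈ RingHom.ker (PadicInt.toZModPow (p := 2) 2) := by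
      rw [RingHom.mem_ker, map_sub, hz, map_one, sub_self]
    rw [PadicInt.ker_toZModPow, Ideal.mem_span_singleton] at this
    norm_num at this
    exact this
  have h4 : PadicInt.toZModPow (p := 2) 2 4 = 0 := by
    have : PadicInt.toZModPow (p := 2) 2 4 = 4 := map_ofNat _ 4
    rw [this]; decide
  have h' := congrArg (PadicInt.toZModPow (p := 2) 2) h
  rw [map_sub, map_mul, map_mul, h4, map_one, zero_mul, sub_zero] at h'
  rcases key _ _ h' with h | h
  · exact Or.inl (back _ h)
  · exact Or.inr (back _ (by rw [map_neg]; exact h))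

theorem hNeg_w : (hNeg : K) * w = w * hNeg := by
  apply K_ext
  · rw [map_mul, map_mul, show prZ (hNeg : K) = -1 from prZ_mkK _ _,
      show prZ w = wMat from prZ_mkK _ _]
    simp
  · rw [sign_mul, sign_mul, show prZ (hNeg : K) = -1 from prZ_mkK _ _,
      show prZ w = wMat from prZ_mkK _ _]
    have : (hNeg : K).1.sign = 1 := rfl
    have : w.1.sign = 1 := rfl
    rw [mul_comm (hNeg : K).1.sign]
    congr 1
    rw [sigma, sigma, ← map_mul, ← map_mul, show wMat * -1 = -1 * wMat by simp,
      hilbertSymbol.comm, mul_right_comm _ (sfun (toQ (-1)))]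

/-- `γ` takes the same value on elements of `K₀` that are conjugate by `w`. -/
theorem conj_w (γ : GenuineChar) {m n : K₀} (h : (m : K) * w = w * n) :
    γ.toHom m = γ.toHom n := by
  have hn : (4 : ℤ_[2]) ∣ prZ n 1 0 := n.2
  obtain ⟨c, hc⟩ := hn
  have hdet : prZ (n : K) 0 0 * prZ (n : K) 1 1 - prZ (n : K) 0 1 * prZ (n : K) 1 0 = 1 := by
    rw [← Matrix.det_fin_two, (prZ (n : K)).det_coe]
  have hdet' : prZ (n : K) 0 0 * prZ (n : K) 1 1 - 4 * (prZ (n : K) 0 1 * c) = 1 := by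
    rw [hc] at hdet; linear_combination hdet
  rcases four_dvd_or hdet' with ha | ha
  · exact conj_w_aux γ h ha
  · have h' : ((hNeg * m : K₀) : K) * w = w * ((hNeg * n : K₀) : K) := by
      push_cast
      rw [mul_assoc, h, ← mul_assoc, hNeg_w, mul_assoc]
    have := conj_w_aux γ h' (by
      push_cast
      rw [map_mul, show prZ (hNeg : K) = -1 from prZ_mkK _ _]
      simpa using ha)
    rw [map_mul, map_mul] at this
    exact mul_left_cancel this

theorem double_coset (γ : GenuineChar) {a b c d : K₀} (h : (a : K) * w * b = c * w * d) :
    γ.toHom a * γ.toHom b = γ.toHom c * γ.toHom d := by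
  have : ((c⁻¹ * a : K₀) : K) * w = w * ((d * b⁻¹ : K₀) : K) := by
    push_cast
    calc (c : K)⁻¹ * a * w = (c : K)⁻¹ * ((a : K) * w * b) * (b : K)⁻¹ := by group
      _ = w * (d * (b : K)⁻¹) := by rw [h]; group
  have := conj_w γ this
  rw [map_mul, map_mul, map_inv, map_inv] at this
  calc γ.toHom a * γ.toHom b = γ.toHom c * ((γ.toHom c)⁻¹ * γ.toHom a) * γ.toHom b := by group
    _ = γ.toHom c * γ.toHom d := by rw [this]; group

end wellDefined

end Cover

namespace Cover

/-- `I_K(γ) = Ind_{K₀}^K γ`. -/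
def IK (γ : GenuineChar) : Submodule ℂ (K → ℂ) where
  carrier := {φ | ∀ (k₀ : K₀) (k : K), φ (k₀ * k) = γ.val k₀ * φ k}
  add_mem' := by
    intro φ ψ hφ hψ k₀ k
    rw [Pi.add_apply, hφ, hψ, Pi.add_apply, mul_add]
  zero_mem' := by intro k₀ k; simp
  smul_mem' := by
    intro c φ hφ k₀ k
    rw [Pi.smul_apply, hφ, Pi.smul_apply, smul_eq_mul, smul_eq_mul, mul_left_comm]

/-- The action `π_R` of `K` on `I_K(γ)` by right translation. -/
noncomputable def piK (γ : GenuineChar) : Representation ℂ K (IK γ) where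
  toFun g :=
    { toFun := fun φ => ⟨fun k => φ.1 (k * g), fun k₀ k => by
        show φ.1 (k₀ * k * g) = γ.val k₀ * φ.1 (k * g)
        rw [mul_assoc, φ.2]⟩
      map_add' := fun _ _ => rfl
      map_smul' := fun _ _ => rfl }
  map_one' := by ext φ k; show φ.1 (k * 1) = φ.1 k; rw [mul_one]
  map_mul' g h := by ext φ k; show φ.1 (k * (g * h)) = φ.1 (k * g * h); rw [mul_assoc]

/-- The Hecke algebra `H_K(γ)` of `γ̄`-biequivariant functions on `K`. -/
def HK (γ : GenuineChar) : Submodule ℂ (K → ℂ) where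
  carrier := {f | ∀ (k₀ k₀' : K₀) (k : K),
    f (k₀ * k * k₀') = starRingEnd ℂ (γ.val k₀) * f k * starRingEnd ℂ (γ.val k₀')}
  add_mem' := by
    intro φ ψ hφ hψ k₀ k₀' k
    rw [Pi.add_apply, hφ, hψ, Pi.add_apply]; ring
  zero_mem' := by intro k₀ k₀' k; simp
  smul_mem' := by
    intro c φ hφ k₀ k₀' k
    rw [Pi.smul_apply, hφ, Pi.smul_apply, smul_eq_mul, smul_eq_mul]; ring

section continuity

variable (γ : GenuineChar)

theorem val_U {k : K₀} (h : (k : K) ∈ U 0) : γ.val k = 1 := by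
  have h1 : γ.toHom k = 1 := by
    apply γ.trivial_K₁
    refine ⟨h.2, ?_, k.2⟩
    have := mem_Γ'.1 h.1 0 0
    rw [Matrix.one_apply_eq] at this
    exact dvd_trans ⟨2, by norm_num⟩ this
  rw [GenuineChar.val, h1, Units.val_one]

theorem val_one : γ.val 1 = 1 := by
  rw [GenuineChar.val, map_one, Units.val_one]

theorem val_mul (k l : K₀) : γ.val (k * l) = γ.val k * γ.val l := by
  rw [GenuineChar.val, map_mul, Units.val_mul]; rfl

theorem val_inv (k : K₀) : γ.val k⁻¹ = (γ.val k)⁻¹ := by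
  rw [GenuineChar.val, map_inv, Units.val_inv_eq_inv_val]; rfl

theorem val_conj (k : K₀) : γ.conj.val k = starRingEnd ℂ (γ.val k) := rfl

theorem norm_val_of_dvd {k : K₀} (h : 4 ∣ prZ k 0 0 - 1) : ‖γ.val k‖ = 1 := by
  rw [GenuineChar.val, char_eq γ k h]
  rcases Int.units_eq_one_or (k : K).1.sign with e | e
  · rw [γ.trivial_K₁]
    · simp
    · refine ⟨by rw [e]; rfl, ?_, ?_⟩ <;> simp only [prZ_mkK] <;> simp
  · rw [γ.genuine _ (by rw [e])]
    simp

theorem norm_val (k : K₀) : ‖γ.val k‖ = 1 := by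
  have hz : prZ (hNeg : K) = -1 := prZ_mkK _ _
  have h1 : ‖γ.val hNeg‖ = 1 := by
    have := norm_val_of_dvd γ (k := hNeg * hNeg) (by
      push_cast
      rw [map_mul, hz]
      simp)
    rw [val_mul, norm_mul, ← sq] at this
    exact (pow_eq_one_iff_of_nonneg (norm_nonneg _) two_ne_zero).1 this
  have hn : (4 : ℤ_[2]) ∣ prZ k 1 0 := k.2
  obtain ⟨c, hc⟩ := hn
  have hdet : prZ (k : K) 0 0 * prZ (k : K) 1 1 - prZ (k : K) 0 1 * prZ (k : K) 1 0 = 1 := by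
    rw [← Matrix.det_fin_two, (prZ (k : K)).det_coe]
  have hdet' : prZ (k : K) 0 0 * prZ (k : K) 1 1 - 4 * (prZ (k : K) 0 1 * c) = 1 := by
    rw [hc] at hdet; linear_combination hdet
  rcases four_dvd_or hdet' with ha | ha
  · exact norm_val_of_dvd γ ha
  · have := norm_val_of_dvd γ (k := hNeg * k) (by
      push_cast
      rw [map_mul, hz]
      simpa using ha)
    rwa [val_mul, norm_mul, h1, one_mul] at this

theorem continuous_of_left {f : K → ℂ} (h : ∀ u ∈ U 0, ∀ k, f (u * k) = f k) : Continuous f := by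
  rw [continuous_iff_continuousAt]
  intro k
  have hU : (fun l => l * k⁻¹) ⁻¹' (U 0 : Set K) ∈ nhds k :=
    ((isOpen_U 0).preimage (continuous_mul_const _)).mem_nhds (by simp)
  refine (continuousAt_const (y := f k)).congr ?_
  filter_upwards [hU] with l hl
  have := h _ hl k
  rw [inv_mul_cancel_right] at this
  exact this.symm

theorem continuous_IK (φ : IK γ) : Continuous φ.1 := by
  refine continuous_of_left fun u hu k => ?_
  have := φ.2 ⟨u, U_le_K₀ hu⟩ k
  rw [val_U γ (k := ⟨u, U_le_K₀ hu⟩) hu, one_mul] at this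
  exact this

theorem continuous_HK (f : HK γ) : Continuous f.1 := by
  refine continuous_of_left fun u hu k => ?_
  have := f.2 ⟨u, U_le_K₀ hu⟩ 1 k
  rw [val_U γ (k := ⟨u, U_le_K₀ hu⟩) hu, val_one, map_one, one_mul, mul_one, OneMemClass.coe_one,
    mul_one] at this
  exact this

theorem integrable_of_continuous {f : K → ℂ} (h : Continuous f) : MeasureTheory.Integrable f haarK :=
  h.integrable_of_hasCompactSupport (HasCompactSupport.of_compactSpace f)

theorem integral_add_aux {f φ ψ : K → ℂ} {c : K → K} (hf : Continuous f) (hφ : Continuous φ)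
    (hψ : Continuous ψ) (hc : Continuous c) :
    ∫ k, f k * (φ (c k) + ψ (c k)) ∂haarK =
      (∫ k, f k * φ (c k) ∂haarK) + ∫ k, f k * ψ (c k) ∂haarK := by
  have h1 : MeasureTheory.Integrable (fun k => f k * φ (c k)) haarK :=
    integrable_of_continuous (hf.mul (hφ.comp hc))
  have h2 : MeasureTheory.Integrable (fun k => f k * ψ (c k)) haarK :=
    integrable_of_continuous (hf.mul (hψ.comp hc))
  rw [← MeasureTheory.integral_add h1 h2]
  simp only [mul_add]

theorem HK_conj_left (f : HK γ.conj) (k₀ : K₀) (k : K) : f.1 (k₀ * k) = γ.val k₀ * f.1 k := by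
  have := f.2 k₀ 1 k
  rw [val_one, map_one, mul_one, OneMemClass.coe_one, mul_one, val_conj, Complex.conj_conj] at this
  exact this

end continuity

/-- `π_L(f)` on `I_K(γ)` for `f` in `H_K(γ̄)`: `(π_L(f) φ)(g) = ∫ f(k) φ(k⁻¹ g) dk`. -/
noncomputable def piL (γ : GenuineChar) (f : HK γ.conj) : IK γ →ₗ[ℂ] IK γ where
  toFun φ := ⟨fun g => ∫ k, f.1 k * φ.1 (k⁻¹ * g) ∂haarK, fun k₀ g => by
    show ∫ k, f.1 k * φ.1 (k⁻¹ * (k₀ * g)) ∂haarK = γ.val k₀ * ∫ k, f.1 k * φ.1 (k⁻¹ * g) ∂haarK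
    rw [← MeasureTheory.integral_mul_left_eq_self _ (k₀ : K), ← MeasureTheory.integral_const_mul]
    congr 1
    ext k
    rw [HK_conj_left, mul_assoc]
    congr 3
    group⟩
  map_add' φ ψ := by
    refine Subtype.ext (funext fun g => ?_)
    show ∫ k, f.1 k * (φ.1 (k⁻¹ * g) + ψ.1 (k⁻¹ * g)) ∂haarK =
      (∫ k, f.1 k * φ.1 (k⁻¹ * g) ∂haarK) + ∫ k, f.1 k * ψ.1 (k⁻¹ * g) ∂haarK
    have hf := continuous_HK _ f
    have h1 := continuous_IK γ φ
    have h2 := continuous_IK γ ψ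
    exact integral_add_aux hf h1 h2 (continuous_inv.mul continuous_const)
  map_smul' c φ := by
    refine Subtype.ext (funext fun g => ?_)
    show ∫ k, f.1 k * (c * φ.1 (k⁻¹ * g)) ∂haarK = c * ∫ k, f.1 k * φ.1 (k⁻¹ * g) ∂haarK
    rw [← MeasureTheory.integral_const_mul]
    simp only [mul_left_comm]

/-- `π_R(f)` on `I_K(γ)` for `f` in `H_K(γ)`: `π_R(f) φ = ∫ f(k) π_R(k) φ dk`. -/
noncomputable def piR (γ : GenuineChar) (f : HK γ) : IK γ →ₗ[ℂ] IK γ where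
  toFun φ := ⟨fun g => ∫ k, f.1 k * (piK γ k φ).1 g ∂haarK, fun k₀ g => by
    show ∫ k, f.1 k * (piK γ k φ).1 (k₀ * g) ∂haarK = γ.val k₀ * ∫ k, f.1 k * (piK γ k φ).1 g ∂haarK
    rw [← MeasureTheory.integral_const_mul]
    congr 1
    ext k
    rw [(piK γ k φ).2, mul_left_comm]⟩
  map_add' φ ψ := by
    refine Subtype.ext (funext fun g => ?_)
    show ∫ k, f.1 k * (φ.1 (g * k) + ψ.1 (g * k)) ∂haarK =
      (∫ k, f.1 k * φ.1 (g * k) ∂haarK) + ∫ k, f.1 k * ψ.1 (g * k) ∂haarK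
    have hf := continuous_HK _ f
    have h1 := continuous_IK γ φ
    have h2 := continuous_IK γ ψ
    exact integral_add_aux hf h1 h2 (continuous_const.mul continuous_id)
  map_smul' c φ := by
    refine Subtype.ext (funext fun g => ?_)
    show ∫ k, f.1 k * (c * φ.1 (g * k)) ∂haarK = c * ∫ k, f.1 k * φ.1 (g * k) ∂haarK
    rw [← MeasureTheory.integral_const_mul]
    simp only [mul_left_comm]

open Classical in
/-- The unit of `H_K(γ)`, supported on `K₀`. -/
noncomputable def unitH (γ : GenuineChar) : HK γ :=
  ⟨fun k => if h : k ∈ K₀ then starRingEnd ℂ (γ.val ⟨k, h⟩) else 0, by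
    intro a b k
    beta_reduce
    by_cases hk : k ∈ K₀
    · have h' : (a : K) * k * b ∈ K₀ := mul_mem (mul_mem a.2 hk) b.2
      rw [dif_pos hk, dif_pos h', ← map_mul, ← map_mul]
      congr 1
      rw [show (⟨(a : K) * k * b, h'⟩ : K₀) = a * ⟨k, hk⟩ * b from rfl]
      simp [GenuineChar.val]
    · rw [dif_neg hk, dif_neg, mul_zero, zero_mul]
      intro h
      apply hk
      have := mul_mem (mul_mem (inv_mem a.2) h) (inv_mem b.2)
      simpa [mul_assoc] using this⟩

/-- `ζ = (1 + γ(-1)) / √2`, where `γ(-1) = γ(h(-1))`. -/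
noncomputable def zeta (γ : GenuineChar) : ℂ := (1 + γ.val hNeg) / (Real.sqrt 2 : ℂ)

open Classical in
/-- `X_w`, supported on `K₀ w K₀`, with `X_w(k₀ w k₀') = γ̄(k₀) γ̄(w) γ̄(k₀')` where `γ(w) = ζ`. -/
noncomputable def Xw (γ : GenuineChar) : HK γ :=
  ⟨fun k => if h : ∃ p : K₀ × K₀, k = p.1 * w * p.2 then
      starRingEnd ℂ (γ.val h.choose.1) * starRingEnd ℂ (zeta γ) *
        starRingEnd ℂ (γ.val h.choose.2)
    else 0, by
    have key : ∀ (p q : K₀ × K₀), (p.1 : K) * w * p.2 = q.1 * w * q.2 →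
        starRingEnd ℂ (γ.val p.1) * starRingEnd ℂ (zeta γ) * starRingEnd ℂ (γ.val p.2) =
        starRingEnd ℂ (γ.val q.1) * starRingEnd ℂ (zeta γ) * starRingEnd ℂ (γ.val q.2) := by
      intro p q h
      have := congrArg (fun u : ℂˣ => (u : ℂ)) (double_coset γ h)
      simp only [Units.val_mul] at this
      rw [← map_mul, ← map_mul, ← map_mul, ← map_mul]
      congr 1
      unfold GenuineChar.val
      linear_combination zeta γ * this
    intro a b k
    beta_reduce
    by_cases hk : ∃ p : K₀ × K₀, k = p.1 * w * p.2
    · have h' : ∃ p : K₀ × K₀, (a : K) * k * b = p.1 * w * p.2 := by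
        obtain ⟨p, rfl⟩ := hk
        exact ⟨(a * p.1, p.2 * b), by push_cast; group⟩
      rw [dif_pos hk, dif_pos h', key _ (a * hk.choose.1, hk.choose.2 * b)]
      · simp [GenuineChar.val]; ring
      · rw [← h'.choose_spec]
        conv_lhs => rw [hk.choose_spec]
        push_cast; group
    · rw [dif_neg hk, dif_neg, mul_zero, zero_mul]
      rintro ⟨p, hp⟩
      refine hk ⟨(a⁻¹ * p.1, p.2 * b⁻¹), ?_⟩
      have : k = (a : K)⁻¹ * (a * k * b) * (b : K)⁻¹ := by group
      rw [this, hp]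
      push_cast; group⟩

/-- `T_w = X_w / √2`. -/
noncomputable def Tw (γ : GenuineChar) : HK γ := (Real.sqrt 2 : ℂ)⁻¹ • Xw γ

/-- `F₋₁ = (2 - T_w) / 3`. -/
noncomputable def Fneg1 (γ : GenuineChar) : HK γ := (1 / 3 : ℂ) • ((2 : ℂ) • unitH γ - Tw γ)

/-- `F₂ = (T_w + 1) / 3`. -/
noncomputable def F2 (γ : GenuineChar) : HK γ := (1 / 3 : ℂ) • (Tw γ + unitH γ)

/-- `f̂(g) = f(g⁻¹)`, a map from `H_K(γ)` to `H_K(γ̄)`. -/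
noncomputable def hat (γ : GenuineChar) (f : HK γ) : HK γ.conj :=
  ⟨fun g => f.1 g⁻¹, by
    intro a b k
    have hinv : ∀ c : K₀, starRingEnd ℂ (γ.val c⁻¹) = starRingEnd ℂ (γ.conj.val c) := by
      intro c
      rw [val_inv, val_conj, Complex.inv_eq_conj (norm_val γ c)]
    show f.1 (a * k * b)⁻¹ = _ * f.1 k⁻¹ * _
    have := f.2 b⁻¹ a⁻¹ k⁻¹
    rw [hinv, hinv] at this
    rw [mul_inv_rev, mul_inv_rev, ← mul_assoc]
    rw [show (b : K)⁻¹ * k⁻¹ * (a : K)⁻¹ = ((b⁻¹ : K₀) : K) * k⁻¹ * ((a⁻¹ : K₀) : K) from rfl, this]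
    ring⟩

/-- `V(j) = π_L(F̂_j) I_K(γ)`, for `f = F_j`. -/
noncomputable def V (γ : GenuineChar) (f : HK γ) : Subrepresentation (piK γ) where
  toSubmodule := LinearMap.range (piL γ (hat γ f))
  apply_mem_toSubmodule g := by
    rintro _ ⟨φ, rfl⟩
    refine ⟨piK γ g φ, ?_⟩
    ext x
    show ∫ k, _ * φ.1 (k⁻¹ * x * g) ∂haarK = ∫ k, _ * φ.1 (k⁻¹ * (x * g)) ∂haarK
    simp only [mul_assoc]

/-- The element of `I_K(γ)` given by an element of `H_K(γ̄)`. -/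
def toIK (γ : GenuineChar) (f : HK γ.conj) : IK γ := ⟨f.1, fun k₀ k => HK_conj_left γ f k₀ k⟩

/-- `I_K(γ)^γ`, the space of `φ` with `π_R(k₀) φ = γ(k₀) φ` for all `k₀` in `K₀`. -/
def typeSpace (γ : GenuineChar) : Submodule ℂ (IK γ) where
  carrier := {φ | ∀ k₀ : K₀, piK γ k₀ φ = γ.val k₀ • φ}
  add_mem' := by
    intro φ ψ hφ hψ k₀
    rw [map_add, hφ, hψ, smul_add]
  zero_mem' := by intro k₀; simp
  smul_mem' := by
    intro c φ hφ k₀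
    rw [map_smul, hφ, smul_comm]

/-- The space of `γ`-spherical vectors of `I_K(γ)` (together with `0`): the eigenspace of `T_w` on
`I_K(γ)^γ` for the eigenvalue `2`. -/
noncomputable def spherical (γ : GenuineChar) : Submodule ℂ (IK γ) :=
  typeSpace γ ⊓ Module.End.eigenspace (piR γ (Tw γ)) 2

end Cover

/-!
The space `I_K(γ)` has dimension `6` because `K₀` has six right cosets in `K`, represented by `1`,
`w u ^ n` for `n < 4` and `w u ^ 2 * w`, where `u` is the standard upper unipotent element; modulo
`4` these are the points of the projective line over `ℤ / 4`. Everything is controlled by the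
function `delta`, supported on `K₀`, whose translates form the basis dual to evaluation at the
representatives (`eq_sum_delta`). In particular `delta` generates `I_K(γ)`, so an equivariant
endomorphism is determined by the image of `delta`, and `π_L(f̂)` sends `delta` to `f̂`.

The vectors of type `γ` are determined by their values at `1` and `w` (`typeSpace_ext`): on the
double coset of `w u ^ 2 * w` the two equivariance conditions contradict each other, since right
translation by `u` acts on it both trivially and through `± i`. Together with the relations
`w ^ 2 = h(-1)` and `u w u w u = h(-1) w` (`braid`) in the cover this makes `L = π_L(T̂_w)` an explicit
`2 × 2` matrix on the type space, and yields the quadratic relation `L ^ 2 = L + 2`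
(`piL_Tw_mul_self`). Hence `π_L(F̂₋₁)` and `π_L(F̂₂)` are complementary idempotents, whose images
are the eigenspaces of `L` for `-1` and `2`. Their dimensions are traces, and the trace of
`π_L(f̂)` is `6 f(1)` (`trace_piL`).

For irreducibility (`V_le_of_stable`), a nonzero stable subspace of `V(j)` contains a vector that
does not vanish at `1`. The sum of its translates by the powers of `u` lies in the type space
(`sum_u_pow_mem_typeSpace`), where an eigenvector of `L` is determined by its value at `1`; so it
is a multiple of `F̂_j`, which generates `V(j)`. Finally `π_R(T_w)` and `L` agree on the type space
(`piR_Tw`), because they agree on `delta` and commute, so that the spherical vectors are the vectors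
of type `γ` in `V(2)`.
-/

namespace Cover

/-! ### Relations in the cover -/

theorem mem_K₀ {k : K} : k ∈ K₀ ↔ 4 ∣ prZ k 1 0 := Iff.rfl

theorem prZ_w : prZ w = wMat := prZ_mkK _ _

theorem prZ_hNeg : prZ (hNeg : K) = -1 := prZ_mkK _ _

/-- The matrix of the standard upper unipotent element. -/
noncomputable def uMat : SLZ := ⟨!![1, 1; 0, 1], by simp [Matrix.det_fin_two]⟩

theorem uMat_coe : (uMat : Matrix (Fin 2) (Fin 2) ℤ_[2]) = !![1, 1; 0, 1] := rfl

/-- The standard upper unipotent element, as an element of `K`. -/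
noncomputable def u : K := mkK uMat 1

theorem prZ_u : prZ u = uMat := prZ_mkK _ _

theorem sfun_toQ_eq_one {g : SLZ} (h : g 1 0 = 0 ∨ IsUnit (g 1 0)) : sfun (toQ g) = 1 := by
  unfold sfun
  rw [if_neg]
  rintro ⟨h0, hodd⟩
  rw [toQ_apply] at h0 hodd
  rcases h with h | h
  · simp [h] at h0
  · have hn := PadicInt.isUnit_iff.1 h
    change ‖((g 1 0 : ℤ_[2]) : ℚ_[2])‖ = 1 at hn
    rw [Padic.norm_eq_zpow_neg_valuation (left_ne_zero_of_mul h0),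
      zpow_eq_one_iff_right₀ (by norm_num) (by norm_num), neg_eq_zero] at hn
    rw [hn] at hodd
    exact absurd hodd (by decide)

theorem sigma_toQ {g h : SLZ} (hg : g 1 0 = 0 ∨ IsUnit (g 1 0)) (hh : h 1 0 = 0 ∨ IsUnit (h 1 0))
    (hgh : (g * h) 1 0 = 0 ∨ IsUnit ((g * h) 1 0)) :
    sigma (toQ g) (toQ h) = hilbertSymbol (xfun (toQ (g * h)) * xfun (toQ g))
      (xfun (toQ (g * h)) * xfun (toQ h)) := by
  rw [sigma, ← map_mul, sfun_toQ_eq_one hg, sfun_toQ_eq_one hh, sfun_toQ_eq_one hgh, mul_one,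
    mul_one, mul_one]

open Classical in
theorem xfun_toQ (g : SLZ) : xfun (toQ g) = if g 1 0 = 0 then (g 1 1 : ℚ_[2]) else g 1 0 := by
  unfold xfun
  rw [toQ_apply, toQ_apply]
  split_ifs <;> simp_all

theorem hilbertSymbol_neg_one : hilbertSymbol (-1 : ℚ_[2]) (-1) = -1 := by
  have := hilbertSymbol.rep_rep 1 0 0 1 0 0
  have e : hilbertSymbol.rep 1 0 0 = -1 := by decide
  rw [e] at this
  push_cast at this
  rw [this]
  decide

theorem hilbertSymbol_one_left (a : ℚ_[2]) : hilbertSymbol 1 a = 1 :=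
  hilbertSymbol.eq_one 1 0 1 (by simp) (by ring)

theorem hilbertSymbol_one_right (a : ℚ_[2]) : hilbertSymbol a 1 = 1 :=
  hilbertSymbol.eq_one 0 1 1 (by simp) (by ring)

theorem hNeg_mul (k : K) : (hNeg : K) * k = k * hNeg := by
  apply K_ext
  · rw [map_mul, map_mul, prZ_hNeg]
    simp
  · rw [sign_mul, sign_mul, prZ_hNeg, mul_comm (hNeg : K).1.sign]
    congr 1
    rw [sigma, sigma, ← map_mul, ← map_mul, show prZ k * -1 = -1 * prZ k by simp,
      hilbertSymbol.comm, mul_right_comm _ (sfun (toQ (-1)))]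

theorem w_mul_w : w * w = hNeg := by
  apply K_ext
  · rw [map_mul, prZ_w, prZ_hNeg]
    ext i j
    fin_cases i <;> fin_cases j <;> simp [wMat_coe]
  · rw [sign_mul, prZ_w, sigma_toQ]
    · rw [xfun_toQ, xfun_toQ]
      simp [wMat_coe, Matrix.mul_apply, Fin.sum_univ_two, hilbertSymbol_one_left]
      simp [mkK, hNeg]
    all_goals simp [wMat_coe, Matrix.mul_apply, Fin.sum_univ_two]

theorem hNeg_mul_hNeg : (hNeg : K) * hNeg = mkK 1 (-1) := by
  apply K_ext
  · rw [map_mul, prZ_hNeg, prZ_mkK]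
    simp
  · rw [sign_mul, prZ_hNeg, sigma_toQ]
    · rw [xfun_toQ, xfun_toQ]
      simp [hilbertSymbol_neg_one]
      simp [mkK]
    all_goals simp

/-- The braid relation of `SL₂`, lifted to the cover. -/
theorem braid : u * w * u * w * u = hNeg * w := by
  apply K_ext
  · simp only [map_mul, prZ_u, prZ_w, prZ_hNeg]
    ext i j
    fin_cases i <;> fin_cases j <;> simp [wMat_coe, uMat_coe]
  · simp only [sign_mul, map_mul, prZ_u, prZ_w, prZ_hNeg]
    rw [← map_mul, ← map_mul, ← map_mul, sigma_toQ, sigma_toQ, sigma_toQ, sigma_toQ, sigma_toQ]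
    · simp only [xfun_toQ]
      simp [wMat_coe, uMat_coe, Matrix.mul_apply, Fin.sum_univ_two, hilbertSymbol_one_left,
        hilbertSymbol_one_right, hilbertSymbol_neg_one]
      simp [u, w, mkK, hNeg]
    all_goals simp [wMat_coe, uMat_coe, Matrix.mul_apply, Fin.sum_univ_two]

theorem prZ_u_pow (n : ℕ) :
    (prZ (u ^ n) : Matrix (Fin 2) (Fin 2) ℤ_[2]) = !![1, (n : ℤ_[2]); 0, 1] := by
  induction n with
  | zero => rw [pow_zero, map_one]; ext i j; fin_cases i <;> fin_cases j <;> simp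
  | succ n ih =>
    rw [pow_succ, map_mul, Matrix.SpecialLinearGroup.coe_mul, ih, prZ_u, uMat_coe]
    ext i j
    fin_cases i <;> fin_cases j <;> simp [Matrix.mul_apply, Fin.sum_univ_two, add_comm]

theorem u_mem_K₀ : u ∈ K₀ := by rw [mem_K₀, prZ_u]; simp [uMat_coe]

/-! ### Cosets of `K₀` -/

/-- Representatives of the right cosets of `K₀` in `K`. -/
noncomputable def cosetRep : Fin 6 → K :=
  ![1, w, w * u, w * u ^ 2, w * u ^ 3, w * u ^ 2 * w]

theorem prZ_w_mul_u_sq_mul_w :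
    (prZ (w * u ^ 2 * w) : Matrix (Fin 2) (Fin 2) ℤ_[2]) = !![-1, 0; 2, -1] := by
  rw [map_mul, map_mul, Matrix.SpecialLinearGroup.coe_mul, Matrix.SpecialLinearGroup.coe_mul,
    prZ_u_pow, prZ_w, wMat_coe]
  ext i j
  fin_cases i <;> fin_cases j <;> simp [Matrix.mul_apply, Fin.sum_univ_two]

/-- The bottom rows of the representatives. -/
theorem prZ_cosetRep (i : Fin 6) :
    prZ (cosetRep i) 1 0 = ((![0, -1, -1, -1, -1, 2] i : ℤ) : ℤ_[2]) ∧
      prZ (cosetRep i) 1 1 = ((![1, 0, -1, -2, -3, -1] i : ℤ) : ℤ_[2]) := by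
  have h (n : ℕ) : prZ (w * u ^ n) 1 0 = -1 ∧ prZ (w * u ^ n) 1 1 = -(n : ℤ_[2]) := by
    rw [map_mul, Matrix.SpecialLinearGroup.coe_mul, prZ_u_pow, prZ_w, wMat_coe]
    simp [Matrix.mul_apply, Fin.sum_univ_two]
  have h5 : prZ (w * u ^ 2 * w) 1 0 = 2 ∧ prZ (w * u ^ 2 * w) 1 1 = -1 := by
    rw [prZ_w_mul_u_sq_mul_w]
    simp
  have h0 := h 0
  have h1 := h 1
  rw [pow_zero, mul_one] at h0
  rw [pow_one] at h1
  fin_cases i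
  · simp [cosetRep]
  · simpa [cosetRep] using h0
  · simpa [cosetRep] using h1
  · simpa [cosetRep] using h 2
  · simpa [cosetRep] using h 3
  · simpa [cosetRep] using h5

theorem four_dvd_iff {z : ℤ_[2]} : 4 ∣ z ↔ PadicInt.toZModPow (p := 2) 2 z = 0 := by
  rw [← RingHom.mem_ker, PadicInt.ker_toZModPow, Ideal.mem_span_singleton]
  norm_num

theorem prZ_mul_inv (k l : K) (i : Fin 2) :
    prZ (k * l⁻¹) i 0 = prZ k i 0 * prZ l 1 1 - prZ k i 1 * prZ l 1 0 := by
  have h : (prZ l)⁻¹ 0 0 = prZ l 1 1 ∧ (prZ l)⁻¹ 1 0 = -prZ l 1 0 := by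
    rw [Matrix.SpecialLinearGroup.SL2_inv_expl]
    exact ⟨rfl, rfl⟩
  rw [map_mul, map_inv, Matrix.SpecialLinearGroup.coe_mul, Matrix.mul_apply, Fin.sum_univ_two,
    h.1, h.2, mul_neg, ← sub_eq_add_neg]

theorem w_notMem_K₀ : w ∉ K₀ := by
  intro hw
  rw [mem_K₀, prZ_w, show wMat 1 0 = -1 from rfl, four_dvd_iff, map_neg, map_one] at hw
  exact absurd hw (by decide)

theorem mul_inv_mem_K₀ {k l : K} :
    k * l⁻¹ ∈ K₀ ↔ 4 ∣ prZ k 1 0 * prZ l 1 1 - prZ k 1 1 * prZ l 1 0 := by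
  rw [mem_K₀, prZ_mul_inv]

theorem existsUnique_cosetRep (k : K) : ∃! i, k * (cosetRep i)⁻¹ ∈ K₀ := by
  -- The condition on `i` compares two points of the projective line over `ℤ / 4`.
  have key : ∀ a b c d : ZMod 4, a * d - b * c = 1 → ∃! i : Fin 6,
      c * ((![1, 0, -1, -2, -3, -1] i : ℤ) : ZMod 4) -
        d * ((![0, -1, -1, -1, -1, 2] i : ℤ) : ZMod 4) = 0 := by
    unfold ExistsUnique
    decide
  have hdet : prZ k 0 0 * prZ k 1 1 - prZ k 0 1 * prZ k 1 0 = 1 := by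
    rw [← Matrix.det_fin_two, (prZ k).det_coe]
  have := congrArg (PadicInt.toZModPow (p := 2) 2) hdet
  rw [map_sub, map_mul, map_mul, map_one] at this
  refine (existsUnique_congr fun i => ?_).2 (key _ _ _ _ this)
  rw [mul_inv_mem_K₀, (prZ_cosetRep i).1, (prZ_cosetRep i).2, four_dvd_iff, map_sub, map_mul,
    map_mul, map_intCast, map_intCast]

/-! ### Values of the character -/

section character

variable (γ : GenuineChar)

theorem val_ne_zero (k : K₀) : γ.val k ≠ 0 := (γ.toHom k).ne_zero

theorem conj_val (k : K₀) : starRingEnd ℂ (γ.val k) = (γ.val k)⁻¹ :=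
  (Complex.inv_eq_conj (norm_val γ k)).symm

theorem val_hNeg_sq : γ.val hNeg ^ 2 = -1 := by
  rw [sq, ← val_mul, GenuineChar.val, γ.genuine _ (by exact hNeg_mul_hNeg)]
  simp

theorem val_u_pow (n : ℕ) : γ.val ⟨u ^ n, pow_mem u_mem_K₀ n⟩ = 1 := by
  have h1 : γ.toHom ⟨u, u_mem_K₀⟩ = 1 := by
    refine γ.trivial_K₁ _ ⟨rfl, ?_, u_mem_K₀⟩
    rw [prZ_u]
    simp [uMat_coe]
  rw [show (⟨u ^ n, pow_mem u_mem_K₀ n⟩ : K₀) = ⟨u, u_mem_K₀⟩ ^ n from rfl, GenuineChar.val,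
    map_pow, h1, one_pow, Units.val_one]

/-- An element of `K₀` whose upper left entry is `-1` modulo `4` has character value `± i`. -/
theorem val_sq_of_dvd {k : K₀} (h : 4 ∣ prZ k 0 0 + 1) : γ.val k ^ 2 = -1 := by
  have e : γ.val (hNeg * k) ^ 2 = 1 := by
    rw [GenuineChar.val, char_eq γ (hNeg * k)]
    · rcases Int.units_eq_one_or ((hNeg * k : K₀) : K).1.sign with e | e
      · rw [γ.trivial_K₁]
        · simp
        · refine ⟨by rw [e]; rfl, ?_, ?_⟩ <;> simp only [prZ_mkK] <;> simp
      · rw [γ.genuine _ (by rw [e])]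
        simp
    · push_cast
      rw [map_mul, prZ_hNeg]
      rw [← dvd_neg]
      simpa [add_comm] using h
  rw [val_mul, mul_pow, val_hNeg_sq] at e
  linear_combination -e

theorem prZ_w_mul_u_sq_mul_w_mul_u :
    (prZ (w * u ^ 2 * w * u) : Matrix (Fin 2) (Fin 2) ℤ_[2]) = !![-1, -1; 2, 1] := by
  rw [map_mul, Matrix.SpecialLinearGroup.coe_mul, prZ_w_mul_u_sq_mul_w, prZ_u, uMat_coe]
  ext i j
  fin_cases i <;> fin_cases j <;> norm_num [Matrix.mul_apply, Fin.sum_univ_two]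

/-- Right translation by `u` moves the last representative by an element of `K₀` at which `γ` is
a primitive fourth root of unity. -/
theorem exists_w_mul_u_sq_mul_w_mul_u :
    ∃ κ : K₀, w * u ^ 2 * w * u = κ * (w * u ^ 2 * w) ∧ γ.val κ ^ 2 = -1 := by
  refine ⟨⟨w * u ^ 2 * w * u * (w * u ^ 2 * w)⁻¹, ?_⟩, by group, val_sq_of_dvd γ ?_⟩
  · rw [mul_inv_mem_K₀, prZ_w_mul_u_sq_mul_w, prZ_w_mul_u_sq_mul_w_mul_u]
    norm_num
  · rw [prZ_mul_inv, prZ_w_mul_u_sq_mul_w, prZ_w_mul_u_sq_mul_w_mul_u]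
    norm_num

/-- The elements `w u ^ 4` and `w` differ on the left by an element of the kernel of `γ`, so that
`n ↦ φ (w u ^ n)` has period `4` for `φ` in `I_K(γ)`. -/
theorem exists_w_mul_u_pow : ∃ k : K₀, w * u ^ 4 = k * w ∧ γ.val k = 1 := by
  have hk : w * u ^ 4 * w⁻¹ ∈ K₀ := by
    rw [mul_inv_mem_K₀, map_mul, Matrix.SpecialLinearGroup.coe_mul, prZ_u_pow, prZ_w, wMat_coe]
    simp [Matrix.mul_apply, Fin.sum_univ_two]
  refine ⟨⟨_, hk⟩, by group, ?_⟩
  rw [← val_u_pow γ 4, GenuineChar.val, GenuineChar.val]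
  congr 1
  exact conj_w γ (by simp)

end character

/-! ### The basis of the induced representation -/

section induced

variable (γ : GenuineChar)

theorem apply_mul_left (φ : IK γ) (k₀ : K₀) (k : K) : φ.1 (k₀ * k) = γ.val k₀ * φ.1 k := φ.2 k₀ k

/-- The function on `K` supported on `K₀` and equal to `γ` there. -/
noncomputable def delta : IK γ := toIK γ (hat γ (unitH γ))

theorem delta_of_mem {k : K} (h : k ∈ K₀) : (delta γ).1 k = γ.val ⟨k, h⟩ := by
  refine (dif_pos (inv_mem h)).trans ?_
  rw [conj_val, ← val_inv]
  congr 1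
  exact Subtype.ext (inv_inv k)

theorem delta_of_notMem {k : K} (h : k ∉ K₀) : (delta γ).1 k = 0 :=
  dif_neg fun h' => h (by simpa using inv_mem h')

/-- The translates of `delta` by the inverses of the coset representatives are a dual system to the
evaluations at the representatives. -/
theorem eq_sum_delta (φ : IK γ) :
    φ = ∑ i, φ.1 (cosetRep i) • piK γ (cosetRep i)⁻¹ (delta γ) := by
  refine Subtype.ext (funext fun k => ?_)
  obtain ⟨i, hi, hu⟩ := existsUnique_cosetRep k
  have hs : (∑ i, φ.1 (cosetRep i) • piK γ (cosetRep i)⁻¹ (delta γ) : IK γ).1 k =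
      ∑ i, φ.1 (cosetRep i) * (delta γ).1 (k * (cosetRep i)⁻¹) := by
    rw [Submodule.coe_sum, Finset.sum_apply]
    rfl
  rw [hs, Finset.sum_eq_single i]
  · rw [delta_of_mem γ hi, mul_comm, ← apply_mul_left]
    group
  · intro j _ hj
    rw [delta_of_notMem γ fun h => hj (hu j h), mul_zero]
  · simp

theorem delta_translate (i j : Fin 6) :
    (piK γ (cosetRep i)⁻¹ (delta γ)).1 (cosetRep j) = if i = j then 1 else 0 := by
  show (delta γ).1 (cosetRep j * (cosetRep i)⁻¹) = _
  split_ifs with h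
  · subst h
    rw [mul_inv_cancel, delta_of_mem γ (one_mem _)]
    exact val_one γ
  · apply delta_of_notMem
    intro hm
    exact h ((existsUnique_cosetRep (cosetRep j)).unique hm (by simp [one_mem]))

/-- Evaluation at the coset representatives identifies `I_K(γ)` with `ℂ ^ 6`. -/
noncomputable def evalEquiv : IK γ ≃ₗ[ℂ] (Fin 6 → ℂ) where
  toFun φ i := φ.1 (cosetRep i)
  map_add' _ _ := rfl
  map_smul' _ _ := rfl
  invFun v := ∑ i, v i • piK γ (cosetRep i)⁻¹ (delta γ)
  left_inv φ := (eq_sum_delta γ φ).symm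
  right_inv v := by
    ext j
    have : (∑ i, v i • piK γ (cosetRep i)⁻¹ (delta γ) : IK γ).1 (cosetRep j) =
        ∑ i, v i * (piK γ (cosetRep i)⁻¹ (delta γ)).1 (cosetRep j) := by
      rw [Submodule.coe_sum, Finset.sum_apply]
      rfl
    beta_reduce
    rw [this]
    simp only [delta_translate]
    simp

theorem finrank_IK : Module.finrank ℂ (IK γ) = 6 := by
  rw [(evalEquiv γ).finrank_eq, Module.finrank_fin_fun]

instance : FiniteDimensional ℂ (IK γ) := (evalEquiv γ).symm.finiteDimensional

/-- Two `K`-equivariant endomorphisms that agree on `delta` are equal. -/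
theorem equivariant_ext {A B : IK γ →ₗ[ℂ] IK γ} (hA : ∀ k φ, A (piK γ k φ) = piK γ k (A φ))
    (hB : ∀ k φ, B (piK γ k φ) = piK γ k (B φ)) (h : A (delta γ) = B (delta γ)) : A = B := by
  ext1 φ
  rw [eq_sum_delta γ φ, map_sum, map_sum]
  simp only [map_smul, hA, hB, h]

end induced

/-! ### The action of the Hecke algebra on the left -/

section integration

/-- Each left coset `r⁻¹ K₀` has measure `1`, so the integral of a right `K₀`-invariant function is
a sum over left coset representatives. -/
theorem integral_eq_sum {f : K → ℂ} (hf : ∀ k (k₀ : K₀), f (k * k₀) = f k) :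
    ∫ k, f k ∂haarK = ∑ i, f (cosetRep i)⁻¹ := by
  have hK : haarK (K₀ : Set K) = 1 :=
    MeasureTheory.Measure.haarMeasure_self (K₀ := compactK₀)
  have hm (i : Fin 6) : MeasurableSet ((fun k => cosetRep i * k) ⁻¹' (K₀ : Set K)) :=
    (isOpen_K₀.preimage (continuous_const_mul _)).measurableSet
  have hf' : f = fun k => ∑ i, ((fun k => cosetRep i * k) ⁻¹' (K₀ : Set K)).indicator
      (fun _ : K => f (cosetRep i)⁻¹) k := by
    funext k
    obtain ⟨i, hi, hu⟩ := existsUnique_cosetRep k⁻¹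
    have hmem (j : Fin 6) : k⁻¹ * (cosetRep j)⁻¹ ∈ K₀ ↔ cosetRep j * k ∈ K₀ := by
      rw [← mul_inv_rev, inv_mem_iff]
    rw [Finset.sum_eq_single i]
    · have hi' := (hmem i).1 hi
      rw [Set.indicator_of_mem (by exact hi'), ← hf (cosetRep i)⁻¹ ⟨_, hi'⟩]
      congr 1
      group
    · intro j _ hj
      rw [Set.indicator_of_notMem]
      exact fun h => hj (hu j ((hmem j).2 h))
    · simp
  conv_lhs => rw [hf']
  rw [MeasureTheory.integral_finsetSum]
  · refine Finset.sum_congr rfl fun i _ => ?_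
    rw [MeasureTheory.integral_indicator_const _ (hm i), MeasureTheory.Measure.real,
      MeasureTheory.measure_preimage_mul, hK]
    simp
  · intro i _
    exact (MeasureTheory.integrable_const _).indicator (hm i)

variable (γ : GenuineChar)

theorem HK_mul_left (f : HK γ) (k₀ : K₀) (k : K) : f.1 (k₀ * k) = (γ.val k₀)⁻¹ * f.1 k := by
  have := f.2 k₀ 1 k
  rwa [val_one, map_one, mul_one, OneMemClass.coe_one, mul_one, conj_val] at this

theorem HK_mul_right (f : HK γ) (k₀ : K₀) (k : K) : f.1 (k * k₀) = f.1 k * (γ.val k₀)⁻¹ := by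
  have := f.2 1 k₀ k
  rwa [val_one, map_one, one_mul, OneMemClass.coe_one, one_mul, conj_val] at this

theorem piL_apply (f : HK γ) (φ : IK γ) (g : K) :
    (piL γ (hat γ f) φ).1 g = ∑ i, f.1 (cosetRep i) * φ.1 (cosetRep i * g) := by
  show ∫ k, f.1 k⁻¹ * φ.1 (k⁻¹ * g) ∂haarK = _
  rw [integral_eq_sum]
  · simp only [inv_inv]
  · intro k k₀
    have h1 := HK_mul_left γ f k₀⁻¹ k⁻¹
    have h2 := apply_mul_left γ φ k₀⁻¹ (k⁻¹ * g)
    push_cast at h1 h2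
    rw [mul_inv_rev, h1, mul_assoc (k₀ : K)⁻¹, h2, mul_mul_mul_comm, inv_mul_cancel₀
      (val_ne_zero γ _), one_mul]

theorem piL_piK (f : HK γ) (k : K) (φ : IK γ) :
    piL γ (hat γ f) (piK γ k φ) = piK γ k (piL γ (hat γ f) φ) := by
  refine Subtype.ext (funext fun g => ?_)
  rw [piL_apply]
  refine Eq.trans ?_ (piL_apply γ f φ (g * k)).symm
  simp only [← mul_assoc]
  rfl

theorem piL_delta (f : HK γ) : piL γ (hat γ f) (delta γ) = toIK γ (hat γ f) := by
  refine Subtype.ext (funext fun g => ?_)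
  rw [piL_apply]
  show _ = f.1 g⁻¹
  obtain ⟨i, hi, hu⟩ := existsUnique_cosetRep g⁻¹
  have hmem (j : Fin 6) : g⁻¹ * (cosetRep j)⁻¹ ∈ K₀ ↔ cosetRep j * g ∈ K₀ := by
    rw [← mul_inv_rev, inv_mem_iff]
  rw [Finset.sum_eq_single i]
  · have e : g⁻¹ = ((⟨_, (hmem i).1 hi⟩⁻¹ : K₀) : K) * cosetRep i := by
      push_cast
      group
    rw [delta_of_mem γ ((hmem i).1 hi)]
    conv_rhs => rw [e, HK_mul_left, val_inv, inv_inv]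
    exact mul_comm _ _
  · intro j _ hj
    rw [delta_of_notMem γ fun h => hj (hu j ((hmem j).2 h)), mul_zero]
  · simp

theorem piL_add (f f' : HK γ) :
    piL γ (hat γ (f + f')) = piL γ (hat γ f) + piL γ (hat γ f') := by
  refine LinearMap.ext fun φ => Subtype.ext (funext fun g => ?_)
  rw [LinearMap.add_apply, Submodule.coe_add, Pi.add_apply, piL_apply, piL_apply, piL_apply,
    ← Finset.sum_add_distrib]
  exact Finset.sum_congr rfl fun i _ => add_mul _ _ _

theorem piL_smul (a : ℂ) (f : HK γ) : piL γ (hat γ (a • f)) = a • piL γ (hat γ f) := by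
  refine LinearMap.ext fun φ => Subtype.ext (funext fun g => ?_)
  rw [LinearMap.smul_apply, Submodule.coe_smul, Pi.smul_apply, piL_apply, piL_apply,
    smul_eq_mul, Finset.mul_sum]
  exact Finset.sum_congr rfl fun i _ => mul_assoc _ _ _

theorem piL_unitH : piL γ (hat γ (unitH γ)) = 1 :=
  equivariant_ext γ (piL_piK γ _) (fun _ _ => rfl) (piL_delta γ _)

/-- The trace of `π_L` at `f̂` only sees the value of `f` at the identity. -/
theorem trace_piL (f : HK γ) : LinearMap.trace ℂ (IK γ) (piL γ (hat γ f)) = 6 * f.1 1 := by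
  have hb (i : Fin 6) :
      Module.Basis.ofEquivFun (evalEquiv γ) i = piK γ (cosetRep i)⁻¹ (delta γ) := by
    rw [Module.Basis.coe_ofEquivFun, LinearEquiv.symm_apply_eq]
    funext j
    show _ = (piK γ (cosetRep i)⁻¹ (delta γ)).1 (cosetRep j)
    rw [delta_translate]
    simp [Pi.single_apply, eq_comm]
  rw [LinearMap.trace_eq_matrix_trace ℂ (Module.Basis.ofEquivFun (evalEquiv γ)), Matrix.trace]
  have hd (i : Fin 6) : (LinearMap.toMatrix (Module.Basis.ofEquivFun (evalEquiv γ))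
      (Module.Basis.ofEquivFun (evalEquiv γ)) (piL γ (hat γ f))).diag i = f.1 1 := by
    rw [Matrix.diag_apply, LinearMap.toMatrix_apply, hb, piL_piK, piL_delta,
      Module.Basis.ofEquivFun_repr_apply]
    show f.1 (cosetRep i * (cosetRep i)⁻¹)⁻¹ = _
    rw [mul_inv_cancel, inv_one]
  simp only [hd]
  simp

end integration

/-! ### The vectors of type `γ` -/

section typeSpace

variable (γ : GenuineChar)

variable {γ} in
theorem typeSpace_apply {φ : IK γ} (h : φ ∈ typeSpace γ) (g : K) (k₀ : K₀) :
    φ.1 (g * k₀) = γ.val k₀ * φ.1 g :=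
  congrFun (congrArg Subtype.val (h k₀)) g

theorem toIK_mem_typeSpace (f : HK γ) : toIK γ (hat γ f) ∈ typeSpace γ := by
  intro k₀
  refine Subtype.ext (funext fun g => ?_)
  show f.1 (g * k₀)⁻¹ = γ.val k₀ * f.1 g⁻¹
  have := HK_mul_left γ f k₀⁻¹ g⁻¹
  rw [val_inv, inv_inv] at this
  rw [mul_inv_rev, ← this]
  rfl

theorem delta_mem_typeSpace : delta γ ∈ typeSpace γ := toIK_mem_typeSpace γ _

theorem piL_mem_typeSpace (f : HK γ) {φ : IK γ} (h : φ ∈ typeSpace γ) :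
    piL γ (hat γ f) φ ∈ typeSpace γ := by
  intro k₀
  rw [← piL_piK, h, map_smul]

variable {γ} in
theorem typeSpace_w_mul_u_sq_mul_w {φ : IK γ} (h : φ ∈ typeSpace γ) : φ.1 (w * u ^ 2 * w) = 0 := by
  obtain ⟨κ, hκ, hs⟩ := exists_w_mul_u_sq_mul_w_mul_u γ
  have h1 := typeSpace_apply h (w * u ^ 2 * w) ⟨u ^ 1, pow_mem u_mem_K₀ 1⟩
  rw [val_u_pow, one_mul] at h1
  simp only [pow_one] at h1
  rw [hκ, apply_mul_left] at h1
  have : γ.val κ ≠ 1 := by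
    intro e
    rw [e] at hs
    norm_num at hs
  by_contra h0
  exact this (mul_right_cancel₀ h0 (h1.trans (one_mul _).symm))

variable {γ} in
theorem typeSpace_w_mul_u_pow {φ : IK γ} (h : φ ∈ typeSpace γ) (n : ℕ) :
    φ.1 (w * u ^ n) = φ.1 w := by
  have := typeSpace_apply h w ⟨u ^ n, pow_mem u_mem_K₀ n⟩
  rwa [val_u_pow, one_mul] at this

theorem ext_cosetRep {φ ψ : IK γ} (h : ∀ i, φ.1 (cosetRep i) = ψ.1 (cosetRep i)) : φ = ψ :=
  (evalEquiv γ).injective (funext h)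

variable {γ} in
/-- An element of the type space is determined by its values at `1` and `w`: the remaining double
coset of `K₀` supports no function that is equivariant on both sides. -/
theorem typeSpace_ext {φ ψ : IK γ} (hφ : φ ∈ typeSpace γ) (hψ : ψ ∈ typeSpace γ)
    (h1 : φ.1 1 = ψ.1 1) (hw : φ.1 w = ψ.1 w) : φ = ψ := by
  apply ext_cosetRep
  have h (n : ℕ) : φ.1 (w * u ^ n) = ψ.1 (w * u ^ n) := by
    rw [typeSpace_w_mul_u_pow hφ, typeSpace_w_mul_u_pow hψ, hw]
  intro i
  fin_cases i
  · exact h1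
  · exact hw
  · simpa [cosetRep] using h 1
  · exact h 2
  · exact h 3
  · exact (typeSpace_w_mul_u_sq_mul_w hφ).trans (typeSpace_w_mul_u_sq_mul_w hψ).symm

end typeSpace

/-! ### The operator `T_w` -/

section hecke

variable (γ : GenuineChar)

/-- The value of `T_w` at `w`. -/
noncomputable def heckeValue : ℂ := (1 - γ.val hNeg) / 2

theorem heckeValue_eq : (Real.sqrt 2 : ℂ)⁻¹ * starRingEnd ℂ (zeta γ) = heckeValue γ := by
  have h2 : (Real.sqrt 2 : ℂ) * (Real.sqrt 2 : ℂ) = 2 := by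
    rw [← Complex.ofReal_mul, Real.mul_self_sqrt (by norm_num)]
    norm_num
  have h0 : (Real.sqrt 2 : ℂ) ≠ 0 := left_ne_zero_of_mul (by rw [h2]; norm_num)
  have hi : (γ.val hNeg)⁻¹ = -γ.val hNeg := by
    apply inv_eq_of_mul_eq_one_right
    linear_combination -(val_hNeg_sq γ)
  rw [zeta, heckeValue, map_div₀, map_add, map_one, conj_val, hi, Complex.conj_ofReal, ← h2]
  field_simp
  ring

theorem heckeValue_mul : heckeValue γ * (1 + γ.val hNeg) = 1 := by
  rw [heckeValue]
  linear_combination -(1 / 2) * val_hNeg_sq γ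

theorem heckeValue_sq : 2 * heckeValue γ ^ 2 * γ.val hNeg = 1 := by
  rw [heckeValue]
  linear_combination (γ.val hNeg / 2 - 1) * val_hNeg_sq γ

theorem Tw_one : (Tw γ).1 1 = 0 := by
  show _ * (Xw γ).1 1 = 0
  rw [show (Xw γ).1 1 = 0 from dif_neg ?_, mul_zero]
  rintro ⟨p, hp⟩
  have e : w = (p.1 : K)⁻¹ * (p.2 : K)⁻¹ := by
    calc w = (p.1 : K)⁻¹ * (p.1 * w * p.2) * (p.2 : K)⁻¹ := by group
      _ = _ := by rw [← hp, mul_one]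
  apply w_notMem_K₀
  rw [e]
  exact mul_mem (inv_mem p.1.2) (inv_mem p.2.2)

theorem Tw_w : (Tw γ).1 w = heckeValue γ := by
  rw [← heckeValue_eq]
  show _ * (Xw γ).1 w = _
  congr 1
  have h : ∃ p : K₀ × K₀, w = p.1 * w * p.2 := ⟨1, by simp⟩
  refine (dif_pos h).trans ?_
  have := double_coset γ (a := 1) (b := 1) (c := h.choose.1) (d := h.choose.2) (by
    rw [← h.choose_spec]
    simp)
  rw [map_one, mul_one] at this
  have := congrArg (fun x : ℂˣ => starRingEnd ℂ (x : ℂ)) this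
  simp only [Units.val_one, map_one, Units.val_mul, map_mul] at this
  unfold GenuineChar.val
  linear_combination -(starRingEnd ℂ (zeta γ)) * this

/-- The double coset of `w u ^ 2 * w` does not support the Hecke algebra. -/
theorem HK_w_mul_u_sq_mul_w (f : HK γ) : f.1 (w * u ^ 2 * w) = 0 := by
  obtain ⟨κ, hκ, hs⟩ := exists_w_mul_u_sq_mul_w_mul_u γ
  have h1 := HK_mul_right γ f ⟨u ^ 1, pow_mem u_mem_K₀ 1⟩ (w * u ^ 2 * w)
  rw [val_u_pow, inv_one, mul_one] at h1
  simp only [pow_one] at h1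
  rw [hκ, HK_mul_left] at h1
  have : (γ.val κ)⁻¹ ≠ 1 := by
    intro e
    rw [inv_eq_one.1 e] at hs
    norm_num at hs
  by_contra h0
  exact this (mul_right_cancel₀ h0 (h1.trans (one_mul _).symm))

theorem Tw_w_mul_u_pow (n : ℕ) : (Tw γ).1 (w * u ^ n) = heckeValue γ := by
  rw [← Tw_w]
  have := HK_mul_right γ (Tw γ) ⟨u ^ n, pow_mem u_mem_K₀ n⟩ w
  rwa [val_u_pow, inv_one, mul_one] at this

theorem piL_Tw_apply (φ : IK γ) (g : K) : (piL γ (hat γ (Tw γ)) φ).1 g =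
    heckeValue γ * (φ.1 (w * g) + φ.1 (w * u * g) + φ.1 (w * u ^ 2 * g) + φ.1 (w * u ^ 3 * g)) := by
  rw [piL_apply, Fin.sum_univ_six]
  show (Tw γ).1 1 * φ.1 (1 * g) + (Tw γ).1 w * φ.1 (w * g) + (Tw γ).1 (w * u) * φ.1 (w * u * g) +
    (Tw γ).1 (w * u ^ 2) * φ.1 (w * u ^ 2 * g) + (Tw γ).1 (w * u ^ 3) * φ.1 (w * u ^ 3 * g) +
    (Tw γ).1 (w * u ^ 2 * w) * φ.1 (w * u ^ 2 * w * g) = _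
  have h1 := Tw_w_mul_u_pow γ 1
  rw [pow_one] at h1
  rw [Tw_one, Tw_w, h1, Tw_w_mul_u_pow, Tw_w_mul_u_pow, HK_w_mul_u_sq_mul_w]
  ring

theorem w_mul_u_inv_mul_w : w * u⁻¹ * w = u * w * u := by
  apply mul_left_cancel (a := (hNeg : K))
  calc (hNeg : K) * (w * u⁻¹ * w) = hNeg * w * u⁻¹ * w := by group
    _ = u * w * u * (w * w) := by rw [← braid]; group
    _ = _ := by rw [w_mul_w, hNeg_mul]

variable {γ}

theorem piL_Tw_one {φ : IK γ} (h : φ ∈ typeSpace γ) :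
    (piL γ (hat γ (Tw γ)) φ).1 1 = 4 * heckeValue γ * φ.1 w := by
  have h1 := typeSpace_w_mul_u_pow h 1
  rw [pow_one] at h1
  rw [piL_Tw_apply]
  simp only [mul_one]
  rw [h1, typeSpace_w_mul_u_pow h, typeSpace_w_mul_u_pow h]
  ring

/-- On the cosets `K₀ w u ^ n w` with `n` odd the braid relation leads back to `w`; for `n = 2` the
value vanishes. -/
theorem piL_Tw_w {φ : IK γ} (h : φ ∈ typeSpace γ) :
    (piL γ (hat γ (Tw γ)) φ).1 w =
      heckeValue γ * (γ.val hNeg * φ.1 1 + (1 + γ.val hNeg) * φ.1 w) := by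
  have hL := apply_mul_left γ φ ⟨u, u_mem_K₀⟩
  have hR := fun g => typeSpace_apply h g ⟨u, u_mem_K₀⟩
  have hu : γ.val ⟨u, u_mem_K₀⟩ = 1 := by simpa only [pow_one] using val_u_pow γ 1
  simp only [hu, one_mul] at hL hR
  have h0 : φ.1 (w * w) = γ.val hNeg * φ.1 1 := by
    rw [w_mul_w, ← apply_mul_left, mul_one]
  have h1 : φ.1 (w * u * w) = γ.val hNeg * φ.1 w := by
    rw [← apply_mul_left, ← braid, hR, mul_assoc, mul_assoc, mul_assoc, hL, ← mul_assoc]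
  have h3 : φ.1 (w * u ^ 3 * w) = φ.1 w := by
    obtain ⟨k, hk, hv⟩ := exists_w_mul_u_pow γ
    have e : w * u ^ 3 * w = k * (u * w * u) := by
      rw [← w_mul_u_inv_mul_w, ← mul_assoc, ← mul_assoc, ← hk]
      group
    rw [e, apply_mul_left, hv, one_mul, hR, hL]
  rw [piL_Tw_apply, h0, h1, h3, typeSpace_w_mul_u_sq_mul_w h]
  ring

variable (γ)

/-- The quadratic relation of the Hecke algebra. -/
theorem piL_Tw_mul_self : piL γ (hat γ (Tw γ)) * piL γ (hat γ (Tw γ)) =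
    piL γ (hat γ (Tw γ)) + (2 : ℂ) • 1 := by
  apply equivariant_ext
  · intro k φ
    simp only [Module.End.mul_apply, piL_piK]
  · intro k φ
    simp only [LinearMap.add_apply, LinearMap.smul_apply, Module.End.one_apply, piL_piK, map_add,
      map_smul]
  have hd := delta_mem_typeSpace γ
  have hT := piL_mem_typeSpace γ (Tw γ) hd
  have e1 := heckeValue_mul γ
  have e2 := heckeValue_sq γ
  refine typeSpace_ext (piL_mem_typeSpace γ (Tw γ) hT)
    (add_mem hT (Submodule.smul_mem _ 2 hd)) ?_ ?_
  · show (piL γ (hat γ (Tw γ)) (piL γ (hat γ (Tw γ)) (delta γ))).1 1 =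
      (piL γ (hat γ (Tw γ)) (delta γ)).1 1 + 2 * (delta γ).1 1
    rw [piL_Tw_one hT, piL_Tw_w hd, piL_Tw_one hd]
    linear_combination 2 * (delta γ).1 1 * e2 + 4 * heckeValue γ * (delta γ).1 w * e1
  · show (piL γ (hat γ (Tw γ)) (piL γ (hat γ (Tw γ)) (delta γ))).1 w =
      (piL γ (hat γ (Tw γ)) (delta γ)).1 w + 2 * (delta γ).1 w
    rw [piL_Tw_w hT, piL_Tw_w hd, piL_Tw_one hd]
    linear_combination 2 * (delta γ).1 w * e2 + heckeValue γ * (γ.val hNeg * (delta γ).1 1 +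
      (1 + γ.val hNeg) * (delta γ).1 w) * e1

end hecke

/-! ### The two summands -/

section summands

variable (γ : GenuineChar)

theorem piL_F2 : piL γ (hat γ (F2 γ)) = (1 / 3 : ℂ) • (piL γ (hat γ (Tw γ)) + 1) := by
  rw [F2, piL_smul, piL_add, piL_unitH]

theorem piL_Fneg1 :
    piL γ (hat γ (Fneg1 γ)) = (1 / 3 : ℂ) • ((2 : ℂ) • 1 - piL γ (hat γ (Tw γ))) := by
  have h : (2 : ℂ) • unitH γ - Tw γ = (2 : ℂ) • unitH γ + (-1 : ℂ) • Tw γ := by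
    module
  rw [Fneg1, h, piL_smul, piL_add, piL_smul, piL_smul, piL_unitH]
  module

theorem isIdempotentElem_piL_F2 : IsIdempotentElem (piL γ (hat γ (F2 γ))) := by
  have h := piL_Tw_mul_self γ
  rw [IsIdempotentElem, piL_F2]
  generalize piL γ (hat γ (Tw γ)) = L at h
  rw [smul_mul_smul_comm, add_mul, mul_add, h, one_mul, mul_one]
  module

theorem piL_Fneg1_eq : piL γ (hat γ (Fneg1 γ)) = 1 - piL γ (hat γ (F2 γ)) := by
  rw [piL_F2, piL_Fneg1]
  module

theorem isIdempotentElem_piL_Fneg1 : IsIdempotentElem (piL γ (hat γ (Fneg1 γ))) := by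
  rw [piL_Fneg1_eq]
  exact IsIdempotentElem.one_sub (R := Module.End ℂ (IK γ)) (isIdempotentElem_piL_F2 γ)

theorem isCompl_V : IsCompl (V γ (Fneg1 γ)).toSubmodule (V γ (F2 γ)).toSubmodule := by
  show IsCompl (LinearMap.range (piL γ (hat γ (Fneg1 γ)))) (LinearMap.range (piL γ (hat γ (F2 γ))))
  rw [piL_Fneg1_eq, ← LinearMap.IsIdempotentElem.ker_eq_range_one_sub (isIdempotentElem_piL_F2 γ)]
  exact (LinearMap.IsIdempotentElem.isCompl (isIdempotentElem_piL_F2 γ)).symm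

theorem mem_V_F2 {φ : IK γ} : φ ∈ (V γ (F2 γ)).toSubmodule ↔
    piL γ (hat γ (Tw γ)) φ = (2 : ℂ) • φ := by
  show φ ∈ LinearMap.range (piL γ (hat γ (F2 γ))) ↔ _
  rw [LinearMap.IsIdempotentElem.mem_range_iff (isIdempotentElem_piL_F2 γ), piL_F2,
    LinearMap.smul_apply, LinearMap.add_apply, Module.End.one_apply]
  constructor
  · intro h
    linear_combination (norm := module) (3 : ℂ) • h
  · intro h
    rw [h]
    module

theorem mem_V_Fneg1 {φ : IK γ} : φ ∈ (V γ (Fneg1 γ)).toSubmodule ↔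
    piL γ (hat γ (Tw γ)) φ = (-1 : ℂ) • φ := by
  show φ ∈ LinearMap.range (piL γ (hat γ (Fneg1 γ))) ↔ _
  rw [LinearMap.IsIdempotentElem.mem_range_iff (isIdempotentElem_piL_Fneg1 γ), piL_Fneg1,
    LinearMap.smul_apply, LinearMap.sub_apply, LinearMap.smul_apply, Module.End.one_apply]
  constructor
  · intro h
    linear_combination (norm := module) (-3 : ℂ) • h
  · intro h
    rw [h]
    module

theorem unitH_one : (unitH γ).1 1 = 1 := by
  have := delta_of_mem γ (one_mem K₀)
  rw [show γ.val ⟨1, _⟩ = 1 from val_one γ] at this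
  rw [← this]
  show _ = (unitH γ).1 1⁻¹
  rw [inv_one]

theorem F2_one : (F2 γ).1 1 = 1 / 3 := by
  show 1 / 3 * ((Tw γ).1 1 + (unitH γ).1 1) = _
  rw [Tw_one, unitH_one]
  norm_num

theorem Fneg1_one : (Fneg1 γ).1 1 = 2 / 3 := by
  show 1 / 3 * (2 * (unitH γ).1 1 - (Tw γ).1 1) = _
  rw [Tw_one, unitH_one]
  norm_num

theorem finrank_range_of_isIdempotentElem {k M : Type*} [Field k] [AddCommGroup M] [Module k M]
    [FiniteDimensional k M] {f : M →ₗ[k] M} (hf : IsIdempotentElem f) :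
    (Module.finrank k (LinearMap.range f) : k) = LinearMap.trace k M f :=
  (LinearMap.IsProj.trace ((LinearMap.isProj_range_iff_isIdempotentElem f).2 hf)).symm

theorem finrank_V {f : HK γ} (hf : IsIdempotentElem (piL γ (hat γ f))) :
    (Module.finrank ℂ (V γ f).toSubmodule : ℂ) = 6 * f.1 1 := by
  rw [← trace_piL]
  exact finrank_range_of_isIdempotentElem hf

theorem finrank_V_F2 : Module.finrank ℂ (V γ (F2 γ)).toSubmodule = 2 := by
  have := finrank_V γ (isIdempotentElem_piL_F2 γ)
  rw [F2_one] at this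
  norm_num at this
  exact_mod_cast this

theorem finrank_V_Fneg1 : Module.finrank ℂ (V γ (Fneg1 γ)).toSubmodule = 4 := by
  have := finrank_V γ (isIdempotentElem_piL_Fneg1 γ)
  rw [Fneg1_one] at this
  norm_num at this
  exact_mod_cast this

theorem toIK_hat_mem_V (f : HK γ) : toIK γ (hat γ f) ∈ (V γ f).toSubmodule :=
  ⟨delta γ, piL_delta γ f⟩

theorem toIK_hat_one (f : HK γ) : (toIK γ (hat γ f)).1 1 = f.1 1 := by
  show f.1 1⁻¹ = _
  rw [inv_one]

end summands

/-! ### Irreducibility -/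

section irreducible

variable (γ : GenuineChar)

theorem heckeValue_ne_zero : heckeValue γ ≠ 0 :=
  left_ne_zero_of_mul_eq_one (heckeValue_mul γ)

/-- An element of the type space that is an eigenvector of `T_w` is determined by its value at
`1`. -/
theorem eq_zero_of_eigenvector {φ : IK γ} (h : φ ∈ typeSpace γ) {μ : ℂ}
    (hμ : piL γ (hat γ (Tw γ)) φ = μ • φ) (h1 : φ.1 1 = 0) : φ = 0 := by
  have := piL_Tw_one h
  rw [hμ] at this
  change μ * φ.1 1 = _ at this
  rw [h1, mul_zero] at this
  refine typeSpace_ext h (zero_mem _) h1 ?_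
  have h4 : 4 * heckeValue γ ≠ 0 := mul_ne_zero (by norm_num) (heckeValue_ne_zero γ)
  exact (mul_eq_zero.1 this.symm).resolve_left h4

theorem span_delta_mem_typeSpace (a b : ℂ) :
    a • delta γ + b • piL γ (hat γ (Tw γ)) (delta γ) ∈ typeSpace γ :=
  add_mem (Submodule.smul_mem _ _ (delta_mem_typeSpace γ))
    (Submodule.smul_mem _ _ (piL_mem_typeSpace γ _ (delta_mem_typeSpace γ)))

/-- The span of `delta` and `T̂_w` contains elements with arbitrary values at `1` and `w`. -/
theorem exists_span_delta (x y : ℂ) : ∃ a b : ℂ,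
    (a • delta γ + b • piL γ (hat γ (Tw γ)) (delta γ)).1 1 = x ∧
      (a • delta γ + b • piL γ (hat γ (Tw γ)) (delta γ)).1 w = y := by
  have hd1 : (delta γ).1 1 = 1 := (delta_of_mem γ (one_mem _)).trans (val_one γ)
  have hdw : (delta γ).1 w = 0 := delta_of_notMem γ w_notMem_K₀
  refine ⟨x, y / (γ.val hNeg * heckeValue γ), ?_, ?_⟩
  · show x * (delta γ).1 1 + _ * (piL γ (hat γ (Tw γ)) (delta γ)).1 1 = x
    rw [hd1, piL_Tw_one (delta_mem_typeSpace γ), hdw]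
    ring
  · show x * (delta γ).1 w + _ * (piL γ (hat γ (Tw γ)) (delta γ)).1 w = y
    have h0 := mul_ne_zero (val_ne_zero γ hNeg) (heckeValue_ne_zero γ)
    rw [hdw, piL_Tw_w (delta_mem_typeSpace γ), hd1, hdw]
    linear_combination div_mul_cancel₀ y h0

/-- Averaging over the powers of `u` maps `I_K(γ)` into the type space. -/
theorem sum_u_pow_mem_typeSpace (φ : IK γ) :
    ∑ n ∈ Finset.range 4, piK γ (u ^ n) φ ∈ typeSpace γ := by
  set ψ : IK γ := ∑ n ∈ Finset.range 4, piK γ (u ^ n) φ with hψ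
  have hv (g : K) : ψ.1 g = φ.1 g + φ.1 (g * u) + φ.1 (g * u ^ 2) + φ.1 (g * u ^ 3) := by
    have : ψ.1 g = ∑ n ∈ Finset.range 4, φ.1 (g * u ^ n) := by
      rw [hψ, Submodule.coe_sum, Finset.sum_apply]
      rfl
    rw [this]
    simp [Finset.sum_range_succ]
  have hper (n : ℕ) : φ.1 (w * u ^ (4 + n)) = φ.1 (w * u ^ n) := by
    obtain ⟨k, hk, hk1⟩ := exists_w_mul_u_pow γ
    rw [pow_add, ← mul_assoc, hk, mul_assoc, apply_mul_left, hk1, one_mul]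
  have hw (n : ℕ) : ψ.1 (w * u ^ n) = ψ.1 w := by
    induction n with
    | zero => rw [pow_zero, mul_one]
    | succ n ih =>
      have e (a b : ℕ) : w * u ^ a * u ^ b = w * u ^ (a + b) := by rw [mul_assoc, pow_add]
      have e' (a : ℕ) : w * u ^ a * u = w * u ^ (a + 1) := by rw [mul_assoc, pow_succ]
      rw [← ih, hv, hv]
      simp only [e, e', add_assoc, Nat.reduceAdd]
      rw [show n + 4 = 4 + n from add_comm _ _, hper]
      ring
  have hy : ψ.1 (w * u ^ 2 * w) = 0 := by
    obtain ⟨κ, hκ, hs⟩ := exists_w_mul_u_sq_mul_w_mul_u γ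
    have h1 (k : K) : φ.1 (w * u ^ 2 * w * (u * k)) = γ.val κ * φ.1 (w * u ^ 2 * w * k) := by
      rw [← mul_assoc, hκ, mul_assoc, apply_mul_left]
    have p1 := h1 1
    have p2 := h1 u
    have p3 := h1 (u ^ 2)
    rw [mul_one, mul_one] at p1
    rw [← sq] at p2
    rw [← pow_succ'] at p3
    -- The four terms are multiples of `1 + γ(κ) + γ(κ) ^ 2 + γ(κ) ^ 3 = 0`.
    rw [hv, p3, p2, p1]
    linear_combination (1 + γ.val κ) * φ.1 (w * u ^ 2 * w) * hs
  -- An element of the type space with the same values at `1` and `w`.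
  obtain ⟨a, b, hχ1, hχw⟩ := exists_span_delta γ (ψ.1 1) (ψ.1 w)
  set χ : IK γ := a • delta γ + b • piL γ (hat γ (Tw γ)) (delta γ)
  have hmem : χ ∈ typeSpace γ := span_delta_mem_typeSpace γ a b
  have hn (n : ℕ) : ψ.1 (w * u ^ n) = χ.1 (w * u ^ n) := by
    rw [hw, typeSpace_w_mul_u_pow hmem, hχw]
  have : ψ = χ := by
    apply ext_cosetRep
    intro i
    fin_cases i
    · exact hχ1.symm
    · exact hχw.symm
    · simpa [cosetRep] using hn 1
    · exact hn 2
    · exact hn 3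
    · exact hy.trans (typeSpace_w_mul_u_sq_mul_w hmem).symm
  rw [this]
  exact hmem

/-- A nonzero `K`-stable subspace of `V(f)` is all of `V(f)`, if `V(f)` consists of eigenvectors
of `T_w` for one eigenvalue: it contains a vector of the type space that does not vanish at `1`, and
some nonzero multiple of that vector is a multiple of `f̂`, which generates `V(f)`. -/
theorem V_le_of_stable {f : HK γ} {μ : ℂ}
    (hμ : ∀ φ ∈ (V γ f).toSubmodule, piL γ (hat γ (Tw γ)) φ = μ • φ) {S : Submodule ℂ (IK γ)}
    (hS : ∀ k, ∀ φ ∈ S, piK γ k φ ∈ S) (hle : S ≤ (V γ f).toSubmodule) (hne : S ≠ ⊥) :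
    (V γ f).toSubmodule ≤ S := by
  obtain ⟨φ, hφ, hφ0⟩ := S.ne_bot_iff.1 hne
  obtain ⟨g, hg⟩ : ∃ g, φ.1 g ≠ 0 := by
    by_contra! h
    exact hφ0 (Subtype.ext (funext h))
  set ψ := ∑ n ∈ Finset.range 4, piK γ (u ^ n) (piK γ g φ) with hψ
  have hψS : ψ ∈ S := S.sum_mem fun n _ => hS _ _ (hS _ _ hφ)
  have hψT : ψ ∈ typeSpace γ := sum_u_pow_mem_typeSpace γ _
  have hψ1 : ψ.1 1 = 4 * φ.1 g := by
    have : ψ.1 1 = ∑ n ∈ Finset.range 4, φ.1 (1 * u ^ n * g) := by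
      rw [hψ, Submodule.coe_sum, Finset.sum_apply]
      rfl
    have h (n : ℕ) : φ.1 (1 * u ^ n * g) = φ.1 g := by
      rw [one_mul]
      refine (apply_mul_left γ φ ⟨u ^ n, pow_mem u_mem_K₀ n⟩ g).trans ?_
      rw [val_u_pow, one_mul]
    rw [this, Finset.sum_congr rfl fun n _ => h n]
    simp
  have hψ0 : ψ.1 1 ≠ 0 := by
    rw [hψ1]
    exact mul_ne_zero (by norm_num) hg
  have hsub : f.1 1 • ψ - ψ.1 1 • toIK γ (hat γ f) = 0 := by
    refine eq_zero_of_eigenvector γ (μ := μ) (sub_mem (Submodule.smul_mem _ _ hψT)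
      (Submodule.smul_mem _ _ (toIK_mem_typeSpace γ f))) (hμ _ (sub_mem
      (Submodule.smul_mem _ _ (hle hψS)) (Submodule.smul_mem _ _ (toIK_hat_mem_V γ f)))) ?_
    show f.1 1 * ψ.1 1 - ψ.1 1 * (toIK γ (hat γ f)).1 1 = 0
    rw [toIK_hat_one]
    ring
  have hfS : toIK γ (hat γ f) ∈ S := by
    rw [← S.smul_mem_iff hψ0, ← sub_eq_zero.1 hsub]
    exact S.smul_mem _ hψS
  rintro _ ⟨χ, rfl⟩
  rw [eq_sum_delta γ χ, map_sum]
  refine S.sum_mem fun i _ => ?_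
  rw [map_smul, piL_piK, piL_delta]
  exact S.smul_mem _ (hS _ _ hfS)

theorem isIrreducible_V {f : HK γ} (hf : f.1 1 ≠ 0) {μ : ℂ}
    (hμ : ∀ φ ∈ (V γ f).toSubmodule, piL γ (hat γ (Tw γ)) φ = μ • φ) :
    Representation.IsIrreducible (k := ℂ) (V := (V γ f).toSubmodule)
      (V γ f).toRepresentation := by
  have hinj : Function.Injective (V γ f).toSubmodule.subtype := Subtype.val_injective
  have hbt : (⊥ : Subrepresentation (V γ f).toRepresentation) ≠ ⊤ := by
    intro h
    have h' : (⟨_, toIK_hat_mem_V γ f⟩ : (V γ f).toSubmodule) ∈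
        (⊥ : Subrepresentation (V γ f).toRepresentation).toSubmodule := by
      rw [h]
      exact Submodule.mem_top
    have h0 : toIK γ (hat γ f) = 0 := congrArg Subtype.val ((Submodule.mem_bot ℂ).1 h')
    apply hf
    rw [← toIK_hat_one, h0]
    rfl
  refine { toNontrivial := ⟨⊥, ⊤, hbt⟩, eq_bot_or_eq_top := fun W => ?_ }
  refine or_iff_not_imp_left.2 fun hW => ?_
  apply Subrepresentation.toSubmodule_injective
  have key := V_le_of_stable γ hμ (S := W.toSubmodule.map (V γ f).toSubmodule.subtype)
    (by
      rintro k _ ⟨x, hx, rfl⟩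
      exact ⟨_, W.apply_mem_toSubmodule k hx, rfl⟩)
    (Submodule.map_subtype_le _ _)
    (by
      refine fun h => hW (Subrepresentation.toSubmodule_injective ?_)
      exact Submodule.map_injective_of_injective hinj (h.trans (Submodule.map_bot _).symm))
  refine eq_top_iff.2 fun x _ => ?_
  obtain ⟨y, hy, e⟩ := key x.2
  rwa [← hinj e]

end irreducible

/-! ### Spherical vectors -/

section spherical

variable (γ : GenuineChar)

theorem piR_apply (f : HK γ) {φ : IK γ} (h : φ ∈ typeSpace γ) (g : K) :
    (piR γ f φ).1 g = ∑ i, f.1 (cosetRep i)⁻¹ * φ.1 (g * (cosetRep i)⁻¹) := by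
  refine integral_eq_sum (f := fun k => f.1 k * φ.1 (g * k)) fun k k₀ => ?_
  rw [HK_mul_right, ← mul_assoc g, typeSpace_apply h, mul_assoc, ← mul_assoc _ (γ.val k₀),
    inv_mul_cancel₀ (val_ne_zero γ _), one_mul]

theorem piR_delta (f : HK γ) : piR γ f (delta γ) = toIK γ (hat γ f) := by
  refine Subtype.ext (funext fun g => ?_)
  rw [piR_apply γ f (delta_mem_typeSpace γ)]
  show _ = f.1 g⁻¹
  obtain ⟨i, hi, hu⟩ := existsUnique_cosetRep g
  rw [Finset.sum_eq_single i]
  · have e : g⁻¹ = (cosetRep i)⁻¹ * ((⟨_, hi⟩⁻¹ : K₀) : K) := by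
      push_cast
      group
    rw [delta_of_mem γ hi]
    conv_rhs => rw [e, HK_mul_right, val_inv, inv_inv]
  · intro j _ hj
    rw [delta_of_notMem γ fun h => hj (hu j h), mul_zero]
  · simp

/-- Left and right convolution commute. -/
theorem piR_piL (f f' : HK γ) {φ : IK γ} (h : φ ∈ typeSpace γ) :
    piR γ f (piL γ (hat γ f') φ) = piL γ (hat γ f') (piR γ f φ) := by
  refine Subtype.ext (funext fun g => ?_)
  rw [piR_apply γ f (piL_mem_typeSpace γ f' h), piL_apply]
  simp only [piL_apply, piR_apply γ f h, Finset.mul_sum]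
  rw [Finset.sum_comm]
  refine Finset.sum_congr rfl fun i _ => Finset.sum_congr rfl fun j _ => ?_
  rw [mul_assoc (cosetRep i), mul_left_comm]

/-- The type space is spanned by `delta` and `T̂_w`. -/
theorem eq_delta_add {φ : IK γ} (h : φ ∈ typeSpace γ) :
    ∃ a b : ℂ, φ = a • delta γ + b • piL γ (hat γ (Tw γ)) (delta γ) := by
  obtain ⟨a, b, h1, hw⟩ := exists_span_delta γ (φ.1 1) (φ.1 w)
  exact ⟨a, b, typeSpace_ext h (span_delta_mem_typeSpace γ a b) h1.symm hw.symm⟩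

/-- The right and the left action of `T_w` agree on the type space. -/
theorem piR_Tw {φ : IK γ} (h : φ ∈ typeSpace γ) :
    piR γ (Tw γ) φ = piL γ (hat γ (Tw γ)) φ := by
  obtain ⟨a, b, rfl⟩ := eq_delta_add γ h
  rw [map_add, map_add, map_smul, map_smul, map_smul, map_smul,
    piR_piL γ _ _ (delta_mem_typeSpace γ), piR_delta, ← piL_delta]

theorem spherical_eq : spherical γ = typeSpace γ ⊓ (V γ (F2 γ)).toSubmodule := by
  ext φ
  rw [spherical, Submodule.mem_inf, Submodule.mem_inf, Module.End.mem_eigenspace_iff, mem_V_F2]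
  exact and_congr_right fun h => by rw [piR_Tw γ h]

theorem toIK_hat_F2_ne_zero : toIK γ (hat γ (F2 γ)) ≠ 0 := by
  intro h
  have := toIK_hat_one γ (F2 γ)
  rw [h, F2_one] at this
  change (0 : ℂ) = 1 / 3 at this
  norm_num at this

theorem toIK_hat_F2_mem_spherical : toIK γ (hat γ (F2 γ)) ∈ spherical γ := by
  rw [spherical_eq]
  exact ⟨toIK_mem_typeSpace γ _, toIK_hat_mem_V γ _⟩

theorem finrank_spherical : Module.finrank ℂ (spherical γ) = 1 := by
  refine finrank_eq_one (⟨_, toIK_hat_F2_mem_spherical γ⟩ : spherical γ)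
    (fun h => toIK_hat_F2_ne_zero γ (congrArg Subtype.val h)) fun φ => ?_
  refine ⟨3 * φ.1.1 1, Subtype.ext ?_⟩
  have hmem : (3 * φ.1.1 1) • toIK γ (hat γ (F2 γ)) - φ.1 ∈ spherical γ :=
    sub_mem (Submodule.smul_mem _ _ (toIK_hat_F2_mem_spherical γ)) φ.2
  have hmem' := (spherical_eq γ).le hmem
  refine sub_eq_zero.1 (eq_zero_of_eigenvector γ hmem'.1 ((mem_V_F2 γ).1 hmem'.2) ?_)
  show 3 * φ.1.1 1 * (toIK γ (hat γ (F2 γ))).1 1 - φ.1.1 1 = 0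
  rw [toIK_hat_one, F2_one]
  ring

end spherical

end Cover

theorem mainTheorem5 (γ : Cover.GenuineChar) :
    -- the induced representation has dimension 6
    Module.finrank ℂ (Cover.IK γ) = 6 ∧
    -- it is the direct sum of `V(-1)` and `V(2)`
    IsCompl (Cover.V γ (Cover.Fneg1 γ)).toSubmodule (Cover.V γ (Cover.F2 γ)).toSubmodule ∧
    -- both summands are irreducible representations of `K`
    Representation.IsIrreducible (k := ℂ) (V := (Cover.V γ (Cover.Fneg1 γ)).toSubmodule)
      (Cover.V γ (Cover.Fneg1 γ)).toRepresentation ∧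
    Representation.IsIrreducible (k := ℂ) (V := (Cover.V γ (Cover.F2 γ)).toSubmodule)
      (Cover.V γ (Cover.F2 γ)).toRepresentation ∧
    -- their dimensions
    Module.finrank ℂ (Cover.V γ (Cover.Fneg1 γ)).toSubmodule = 4 ∧
    Module.finrank ℂ (Cover.V γ (Cover.F2 γ)).toSubmodule = 2 ∧
    -- `F̂₂` is a `γ`-spherical vector in `V(2)`
    Cover.toIK γ (Cover.hat γ (Cover.F2 γ)) ∈ Cover.V γ (Cover.F2 γ) ∧
    Cover.toIK γ (Cover.hat γ (Cover.F2 γ)) ≠ 0 ∧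
    Cover.toIK γ (Cover.hat γ (Cover.F2 γ)) ∈ Cover.spherical γ ∧
    -- the space of `γ`-spherical vectors is one-dimensional and lies in `V(2)`
    Module.finrank ℂ (Cover.spherical γ) = 1 ∧
    Cover.spherical γ ≤ (Cover.V γ (Cover.F2 γ)).toSubmodule ∧
    -- `V(-1)` has no `γ`-spherical vector
    (Cover.V γ (Cover.Fneg1 γ)).toSubmodule ⊓ Cover.spherical γ = ⊥ := by
  have hs := Cover.spherical_eq γ
  refine ⟨Cover.finrank_IK γ, Cover.isCompl_V γ, ?_, ?_, Cover.finrank_V_Fneg1 γ,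
    Cover.finrank_V_F2 γ, Cover.toIK_hat_mem_V γ _, Cover.toIK_hat_F2_ne_zero γ,
    Cover.toIK_hat_F2_mem_spherical γ, Cover.finrank_spherical γ, hs ▸ inf_le_right, ?_⟩
  · exact Cover.isIrreducible_V γ (by rw [Cover.Fneg1_one]; norm_num)
      fun φ => (Cover.mem_V_Fneg1 γ).1
  · exact Cover.isIrreducible_V γ (by rw [Cover.F2_one]; norm_num)
      fun φ => (Cover.mem_V_F2 γ).1
  · rw [hs]
    exact ((Cover.isCompl_V γ).disjoint.mono_right inf_le_right).eq_bot
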